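/- Let $k$ be a field of characteristic zero. For a homogeneous ideal $I\subset R=k[x_1,\dots,x_r]$ such that $A=R/I$ is artinian and $\dim_k A_1=r$, we say that $A$ has embedding dimension $r$, $h$-vector $h=(h_0,\dots,h_e)$ with $h_i=\dim_kA_i$ ($e$ the last degree with $A_e\ne0$), and socle-vector $s=(s_0,\dots,s_e)$ with $s_i=\dim_k\mathrm{soc}(A)_i$, where $\mathrm{soc}(A)$ is the annihilator of the ideal $(\overline{x_1},\dots,\overline{x_r})\subset A$. A vector $h$ is admissible for $(r,s)$ if some such algebra over $k$ has embedding dimension $r$, socle-vector $s$ and $h$-vector $h$. The minimal embedding dimension of $s$ is the least $\rho$ for which some such algebra over $k$ has embedding dimension $\rho$ and socle-vector $s$. Let $r>1$ and $e>1$, let $s=(s_0,\dots,s_e)$ be a vector of non-negative integers with $s_0=0$ and $s_e>0$, and suppose that $r$ is at least the minimal embedding dimension of $s$. Put $N(r,d)=\binom{r-1+d}{d}$ and $r_d=N(r,d)-N(r,0)s_d-N(r,1)s_{d+1}-\dots-N(r,e-d)s_e$ for $0\le d\le e$. For positive integers $n,i$ with $i$-binomial expansion $n=\binom{n_i}{i}+\binom{n_{i-1}}{i-1}+\dots+\binom{n_j}{j}$,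 $n_i>n_{i-1}>\dots>n_j\ge j\ge1$, put $(n_{(i)})^{+1}_{+1}=\binom{n_i+1}{i+1}+\binom{n_{i-1}+1}{i}+\dots+\binom{n_j+1}{j+1}$ (and $(0_{(i)})^{+1}_{+1}=0$). Let $H=(h_0,\dots,h_e)$ be given by $h_0=1$, $h_1=r$ and $$h_i=\min\{((h_{i-1}-s_{i-1})_{(i-1)})^{+1}_{+1},\ N(r,i)-r_i\}\qquad(2\le i\le e).$$ Let $c$ be the largest index in $\{0,\dots,e\}$ such that $h_c=N(r,c)$, and let $t$ be the largest index in $\{0,\dots,e\}$ such that $$h_t=((h_{t-1}-s_{t-1})_{(t-1)})^{+1}_{+1}<N(r,t)-r_t,$$ where the middle term is read as $1$ for $t=0$ and as $r$ for $t=1$. Then $H$ is admissible for the pair $(r,s)$ in each of the following cases: (i) $c=t+1$; (ii) $c=t$ and $s_c\le\max\{N(r,c)-h_{c+1},0\}$; (iii) $c\le t-1$ and $s_c\ge N(r,c)-c$. -/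

import Mathlib

namespace SocleData

/-! ### Numerical data -/

/-- `N(r,d)`, the number of monomials of degree `d` in `r` variables
(equal to `(r-1+d).choose d` for `r ≥ 1`). -/
def N (r d : ℕ) : ℕ := (r + d - 1).choose d

/-- The number `N(r,0) s_d + N(r,1) s_{d+1} + ⋯ + N(r,e-d) s_e`, that is, `N(r,d) - r_d` with
`r_d = N(r,d) - N(r,0) s_d - N(r,1) s_{d+1} - ⋯ - N(r,e-d) s_e`. -/
def derivBound (r e : ℕ) (s : ℕ → ℕ) (d : ℕ) : ℕ :=
  ∑ j ∈ Finset.range (e + 1 - d), N r j * s (d + j)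

/-- `macaulayUp i n` is `(n_(i))^{+1}_{+1}`: if `n = ∑_{l=j}^{i} (n_l choose l)`, with
`n_i > ⋯ > n_j ≥ j ≥ 1`, is the `i`-binomial expansion of `n`, then
`macaulayUp i n = ∑_{l=j}^{i} (n_l + 1 choose l + 1)`; see `macaulayUp_eq`.
The expansion is computed greedily: its leading entry is the largest `m` with
`m.choose i ≤ n` (such an `m` is less than `n + i`). -/
def macaulayUp : ℕ → ℕ → ℕ
  | 0, _ => 0
  | i + 1, n =>
    if n = 0 then 0
    else
      (Nat.findGreatest (fun m => m.choose (i + 1) ≤ n) (n + i) + 1).choose (i + 2) +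
        macaulayUp i
          (n - (Nat.findGreatest (fun m => m.choose (i + 1) ≤ n) (n + i)).choose (i + 1))

/-- `n = ∑_{l=j}^{i} (a_l choose l)` with `a_i > ⋯ > a_j ≥ j ≥ 1`. -/
def IsBinomialExpansion (i n j : ℕ) (a : ℕ → ℕ) : Prop :=
  1 ≤ j ∧ j ≤ i ∧ j ≤ a j ∧ StrictMonoOn a (Set.Icc j i) ∧
    n = ∑ l ∈ Finset.Icc j i, (a l).choose l

theorem IsBinomialExpansion.lt {i n j : ℕ} {a : ℕ → ℕ} (h : IsBinomialExpansion i n j a) :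
    n < (a i + 1).choose i := by
  obtain ⟨h1, hji, hja, hmono, hn⟩ := h
  subst hn
  induction i, hji using Nat.le_induction with
  | base =>
    obtain ⟨p, rfl⟩ : ∃ p, j = p + 1 := ⟨j - 1, by omega⟩
    simp only [Finset.Icc_self, Finset.sum_singleton]
    rw [Nat.choose_succ_succ']
    have := Nat.choose_pos (n := a (p + 1)) (k := p) (by omega)
    omega
  | succ q hq ih =>
    have ih := ih (hmono.mono (Set.Icc_subset_Icc_right (Nat.le_succ q)))
    rw [Finset.sum_Icc_succ_top (by omega), Nat.choose_succ_succ]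
    have hlt : a q < a (q + 1) := hmono ⟨hq, by omega⟩ ⟨by omega, le_rfl⟩ (Nat.lt_succ_self q)
    have := Nat.choose_le_choose q (show a q + 1 ≤ a (q + 1) from hlt)
    simp only [Nat.succ_eq_add_one]
    omega

theorem IsBinomialExpansion.le {i n j : ℕ} {a : ℕ → ℕ} (h : IsBinomialExpansion i n j a) :
    i ≤ a i := by
  obtain ⟨h1, hji, hja, hmono, -⟩ := h
  induction i, hji using Nat.le_induction with
  | base => exact hja
  | succ q hq ih =>
    have ih := ih (hmono.mono (Set.Icc_subset_Icc_right (Nat.le_succ q)))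
    have hlt : a q < a (q + 1) := hmono ⟨hq, by omega⟩ ⟨by omega, le_rfl⟩ (Nat.lt_succ_self q)
    omega

theorem succ_le_choose (p i : ℕ) : p + 1 ≤ (p + (i + 1)).choose (i + 1) := by
  induction p with
  | zero => simp
  | succ p ih =>
    rw [show p + 1 + (i + 1) = (p + (i + 1)) + 1 by omega, Nat.choose_succ_succ']
    have := Nat.choose_pos (n := p + (i + 1)) (k := i) (by omega)
    omega

theorem findGreatest_eq {i n j : ℕ} {a : ℕ → ℕ} (h : IsBinomialExpansion (i + 1) n j a) :
    Nat.findGreatest (fun m => m.choose (i + 1) ≤ n) (n + i) = a (i + 1) := by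
  have hlt := h.lt
  have hle := h.le
  have hn : (a (i + 1)).choose (i + 1) ≤ n := by
    rw [h.2.2.2.2]
    exact Finset.single_le_sum (f := fun l => (a l).choose l) (fun _ _ => Nat.zero_le _)
      (Finset.mem_Icc.2 ⟨h.2.1, le_rfl⟩)
  rw [Nat.findGreatest_eq_iff]
  refine ⟨?_, fun _ => hn, fun m hm _ hmn => ?_⟩
  · obtain ⟨p, hp⟩ : ∃ p, a (i + 1) = p + (i + 1) := ⟨a (i + 1) - (i + 1), by omega⟩
    have hb := succ_le_choose p i
    rw [hp] at hn ⊢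
    omega
  · have := Nat.choose_le_choose (i + 1) (show a (i + 1) + 1 ≤ m from hm)
    omega

/-- The greedy computation agrees with the formula through the `i`-binomial expansion. -/
theorem macaulayUp_eq {i n j : ℕ} {a : ℕ → ℕ} (h : IsBinomialExpansion i n j a) :
    macaulayUp i n = ∑ l ∈ Finset.Icc j i, (a l + 1).choose (l + 1) := by
  induction i generalizing n with
  | zero => have := h.1; have := h.2.1; omega
  | succ i ih =>
    have hg := findGreatest_eq h
    have hle := h.le
    obtain ⟨h1, hji, hja, hmono, hn⟩ := h
    rw [Finset.sum_Icc_succ_top hji] at hn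
    have hpos : 0 < (a (i + 1)).choose (i + 1) := Nat.choose_pos hle
    rw [macaulayUp, if_neg (by omega), hg, Finset.sum_Icc_succ_top hji, add_comm]
    congr 1
    rw [show n - (a (i + 1)).choose (i + 1) = ∑ l ∈ Finset.Icc j i, (a l).choose l by omega]
    rcases Nat.lt_or_ge i j with hij | hij
    · rw [Finset.Icc_eq_empty (by omega)]
      cases i <;> simp [macaulayUp]
    · exact ih ⟨h1, hij, hja, hmono.mono (Set.Icc_subset_Icc_right (Nat.le_succ i)), rfl⟩

/-- The vector `H = (h_0, …, h_e)`: `h_0 = 1`, `h_1 = r` and, for `2 ≤ i ≤ e`,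
`h_i = min {((h_{i-1} - s_{i-1})_(i-1))^{+1}_{+1}, N(r,i) - r_i}` (and `h_i = 0` for `i > e ≥ 1`,
the second entry of the minimum being then an empty sum). -/
def upperBound (r e : ℕ) (s : ℕ → ℕ) : ℕ → ℕ
  | 0 => 1
  | 1 => r
  | i + 2 => min (macaulayUp (i + 1) (upperBound r e s (i + 1) - s (i + 1)))
      (derivBound r e s (i + 2))

/-- The term `((h_{i-1} - s_{i-1})_(i-1))^{+1}_{+1}`, with the conventions that it is `1` for
`i = 0` and `r` for `i = 1`. -/
def growthTerm (r e : ℕ) (s : ℕ → ℕ) : ℕ → ℕ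
  | 0 => 1
  | 1 => r
  | i + 2 => macaulayUp (i + 1) (upperBound r e s (i + 1) - s (i + 1))

/-- `c` is the largest index in `{0, …, e}` such that `h_c` is generic, i.e. `h_c = N(r,c)`. -/
def IsLastGeneric (r e : ℕ) (s : ℕ → ℕ) (c : ℕ) : Prop :=
  IsGreatest {i | i ≤ e ∧ upperBound r e s i = N r i} c

/-- `t` is the largest index in `{0, …, e}` such that
`h_t = ((h_{t-1} - s_{t-1})_(t-1))^{+1}_{+1} < N(r,t) - r_t`. -/
def IsLastGrowth (r e : ℕ) (s : ℕ → ℕ) (t : ℕ) : Prop :=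
  IsGreatest {i | i ≤ e ∧ upperBound r e s i = growthTerm r e s i ∧
    growthTerm r e s i < derivBound r e s i} t

/-! ### Standard graded artinian algebras -/

section Algebra

variable {k : Type*} [Field k] {r : ℕ}

attribute [local instance] MvPolynomial.gradedAlgebra

/-- The homogeneous component `A_i` of `A = k[x_1, …, x_r]/I`. -/
noncomputable def gradedPiece (I : Ideal (MvPolynomial (Fin r) k)) (i : ℕ) :
    Submodule k (MvPolynomial (Fin r) k ⧸ I) :=
  (MvPolynomial.homogeneousSubmodule (Fin r) k i).map (Ideal.Quotient.mkₐ k I).toLinearMap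

/-- The socle of `A = k[x_1, …, x_r]/I`: the annihilator of the ideal generated by the classes of
the variables. -/
noncomputable def socle (I : Ideal (MvPolynomial (Fin r) k)) : Ideal (MvPolynomial (Fin r) k ⧸ I) :=
  (Ideal.span (Set.range fun j : Fin r => Ideal.Quotient.mk I (MvPolynomial.X j))).annihilator

/-- The homogeneous component `soc(A)_i` of the socle of `A = k[x_1, …, x_r]/I`. -/
noncomputable def soclePiece (I : Ideal (MvPolynomial (Fin r) k)) (i : ℕ) :
    Submodule k (MvPolynomial (Fin r) k ⧸ I) :=
  (socle I).restrictScalars k ⊓ gradedPiece I i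

/-- `k[x_1, …, x_r]/I` is a standard graded artinian algebra of embedding dimension `r` (so that
`I` contains no non-zero linear form) with socle-vector `s` and `h`-vector `h`.
Vectors are extended by zero to all degrees. -/
structure HasData (I : Ideal (MvPolynomial (Fin r) k)) (s h : ℕ → ℕ) : Prop where
  homogeneous : I.IsHomogeneous (MvPolynomial.homogeneousSubmodule (Fin r) k)
  artinian : IsArtinianRing (MvPolynomial (Fin r) k ⧸ I)
  embDim : Module.finrank k (gradedPiece I 1) = r
  socleVector : ∀ i, Module.finrank k (soclePiece I i) = s i
  hVector : ∀ i, Module.finrank k (gradedPiece I i) = h i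

end Algebra

/-- `h` is admissible for the pair `(r,s)`: it is the `h`-vector of some algebra over `k` with
embedding dimension `r` and socle-vector `s`. -/
def Admissible (k : Type*) [Field k] (r : ℕ) (s h : ℕ → ℕ) : Prop :=
  ∃ I : Ideal (MvPolynomial (Fin r) k), HasData I s h

/-- The least embedding dimension of an algebra over `k` with socle-vector `s`. -/
noncomputable def minEmbDim (k : Type*) [Field k] (s : ℕ → ℕ) : ℕ :=
  sInf {ρ | ∃ h : ℕ → ℕ, Admissible k ρ s h}

end SocleData

/-!
By Macaulay duality an artinian algebra `A = R/I` corresponds to the spaces `I_i^⊥` of functionals on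
`R_i`, closed under contraction by the variables; the socle in degree `i` counts the functionals of
degree `i` that are not contractions of functionals of degree `i + 1`. The algebra with `h`-vector
`H` is constructed by choosing these functionals.

All functionals are combinations of evaluations at the points `P_l = (z_1^l, …, z_r^l)`, where the
`z_v` are distinct primes. The value of a monomial at `P_l` is the `l`-th power of its value at `z`,
and monomials have distinct values at `z`, so Vandermonde determinants show that the points impose
independent conditions on forms (`finrank_map_evalPoints`). Contracting the evaluation at `P_l` by a
monomial multiplies it by the value of that monomial. For coefficients `τ_l` outside a
hypersurface, the functionals `f ↦ ∑_{l < D} τ_l u^l f(P_l)`, with one scalar `u` for each generator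
of the socle, therefore have contractions spanning a space of the largest dimension that the number
`D` of points, the number of monomials and the number of contractions allow (`exists_generic`): for
special `τ` the matrix in question is a product of two Vandermonde matrices.

Let `t` be the last index of growth. Beyond degree `t` the vector `H` counts contractions, and the
algebra is defined by generic functionals on `D` points. In degrees `i ≤ t` it is defined by
vanishing at the first `H_i` points. Below degree `c` the socle is zero and every form is counted;
between `c` and `t`, in the third case, `H_c - s_c ≤ c` makes the growth constant, so that
`H_{i+1} = H_i - s_i`: passing from degree `i + 1` down to `i`, the socle accounts for `s_i` new
points. With `D = H_t - s_t` points (or more, if `H_t` is generic and `s_t = 0`) the dimensions are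
the required ones (`admissible_of_numerics`).

There remains `t < e`, the only place where the minimal embedding dimension enters. If `t = e`, then
`H_e < s_e`, and `H_{i+1} = H_i - s_i ≤ i` from degree `c` on. An algebra in at most `r` variables
with socle-vector `s` has an `h`-vector bounded by `H` in these degrees, since by Macaulay's theorem
a dimension that is at most `i` in degree `i` does not grow; so its socle in degree `e` is too small.
This case of Macaulay's theorem (`finrank_succ_le_of_finrank_le`) is reduced to monomials by taking
leading monomials, and is proved there by induction on the number of variables
(`card_le_of_shadow_subset`). That some algebra with socle-vector `s` exists at all follows from the
same construction (`exists_admissible`).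
-/

namespace SocleData

/-! ### The numbers `N(r,d)` and the growth function -/

theorem N_zero (r : ℕ) : N r 0 = 1 := by simp [N]

theorem N_one (r : ℕ) : N r 1 = r := by simp [N]

theorem N_mono_left {r r' : ℕ} (h : r ≤ r') (d : ℕ) : N r d ≤ N r' d :=
  Nat.choose_le_choose d (by omega)

theorem N_le_succ {r : ℕ} (hr : 0 < r) (d : ℕ) : N r d ≤ N r (d + 1) := by
  obtain ⟨q, rfl⟩ : ∃ q, r = q + 1 := ⟨r - 1, by omega⟩
  simp only [N]
  rw [show q + 1 + (d + 1) - 1 = (q + d) + 1 by omega, show q + 1 + d - 1 = q + d by omega,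
    Nat.choose_succ_succ']
  omega

theorem N_mono_right {r : ℕ} (hr : 0 < r) : Monotone (N r) :=
  monotone_nat_of_le_succ (N_le_succ hr)

theorem N_pos {r : ℕ} (hr : 0 < r) (d : ℕ) : 0 < N r d :=
  Nat.choose_pos (by omega)

/-- The defining recursion of `macaulayUp`, in terms of the leading entry of the expansion. -/
theorem exists_macaulayUp_succ {i n : ℕ} (hn : 0 < n) :
    ∃ m, i + 1 ≤ m ∧ m.choose (i + 1) ≤ n ∧ n < (m + 1).choose (i + 1) ∧
      macaulayUp (i + 1) n =
        (m + 1).choose (i + 2) + macaulayUp i (n - m.choose (i + 1)) := by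
  obtain ⟨p, rfl⟩ : ∃ p, n = p + 1 := ⟨n - 1, by omega⟩
  have h1 : (i + 1).choose (i + 1) ≤ p + 1 := by simp
  refine ⟨Nat.findGreatest (fun m => m.choose (i + 1) ≤ p + 1) (p + 1 + i),
    Nat.le_findGreatest (by omega) h1,
    Nat.findGreatest_spec (P := fun m => m.choose (i + 1) ≤ p + 1) (by omega) h1, ?_,
    by rw [macaulayUp, if_neg (by omega)]⟩
  by_contra! hcon
  have h2 : p + 2 ≤ (p + 1 + (i + 1)).choose (i + 1) := succ_le_choose (p + 1) i
  by_cases hle : Nat.findGreatest (fun m => m.choose (i + 1) ≤ p + 1) (p + 1 + i) + 1 ≤ p + 1 + i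
  · have := Nat.le_findGreatest (P := fun m => m.choose (i + 1) ≤ p + 1) hle hcon
    omega
  · have := Nat.choose_le_choose (i + 1) (show p + 1 + (i + 1) ≤
      Nat.findGreatest (fun m => m.choose (i + 1) ≤ p + 1) (p + 1 + i) + 1 by omega)
    omega

theorem macaulayUp_zero_right (i : ℕ) : macaulayUp i 0 = 0 := by
  cases i <;> simp [macaulayUp]

theorem macaulayUp_lt {i n m : ℕ} (h : n < (m + 1).choose i) :
    macaulayUp i n < (m + 2).choose (i + 1) := by
  induction i generalizing n m with
  | zero => simp [macaulayUp]
  | succ i ih =>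
    rcases Nat.eq_zero_or_pos n with rfl | hn
    · have : i + 1 ≤ m + 1 := by
        by_contra! hcon
        rw [Nat.choose_eq_zero_of_lt hcon] at h
        omega
      rw [macaulayUp_zero_right]
      exact Nat.choose_pos (by omega)
    · obtain ⟨q, hq1, hq2, hq3, hq4⟩ := exists_macaulayUp_succ (i := i) hn
      have hqm : q ≤ m := by
        by_contra! hcon
        have := Nat.choose_le_choose (i + 1) (show m + 1 ≤ q from hcon)
        omega
      obtain ⟨p, rfl⟩ : ∃ p, q = p + 1 := ⟨q - 1, by omega⟩
      have h3 : n - (p + 1).choose (i + 1) < (p + 1).choose i := by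
        rw [Nat.choose_succ_succ' (p + 1)] at hq3
        omega
      have h4 := ih h3
      have h5 := Nat.choose_le_choose (i + 2) (show p + 3 ≤ m + 2 by omega)
      have h6 : (p + 3).choose (i + 2) = (p + 2).choose (i + 1) + (p + 2).choose (i + 2) :=
        Nat.choose_succ_succ' _ _
      rw [hq4]
      change (p + 2).choose (i + 2) + _ < (m + 2).choose (i + 2)
      omega

/-- A quotient that is not everything in degree `i` is not everything in degree `i + 1`. -/
theorem macaulayUp_lt_N {r i n : ℕ} (hr : 1 < r) (h : n < N r i) :
    macaulayUp i n < N r (i + 1) := by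
  obtain ⟨q, rfl⟩ : ∃ q, r = q + 2 := ⟨r - 2, by omega⟩
  have := macaulayUp_lt (i := i) (n := n) (m := q + i) (by
    rw [N, show q + 2 + i - 1 = q + i + 1 by omega] at h
    exact h)
  rwa [N, show q + 2 + (i + 1) - 1 = q + i + 2 by omega]

theorem macaulayUp_N {r i : ℕ} (hr : 1 < r) (hi : 0 < i) :
    macaulayUp i (N r i) = N r (i + 1) := by
  obtain ⟨q, rfl⟩ : ∃ q, r = q + 2 := ⟨r - 2, by omega⟩
  obtain ⟨j, rfl⟩ : ∃ j, i = j + 1 := ⟨i - 1, by omega⟩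
  have hN : N (q + 2) (j + 1) = (q + j + 2).choose (j + 1) := by
    rw [N]; congr 1; omega
  obtain ⟨m, hm1, hm2, hm3, hm4⟩ :=
    exists_macaulayUp_succ (i := j) (n := N (q + 2) (j + 1)) (N_pos (by omega) _)
  have hm : m = q + j + 2 := by
    rw [hN] at hm2 hm3
    apply le_antisymm
    · by_contra! hcon
      have h1 := Nat.choose_le_choose (j + 1) (show q + j + 3 ≤ m from hcon)
      have h2 : (q + j + 3).choose (j + 1) =
        (q + j + 2).choose j + (q + j + 2).choose (j + 1) := Nat.choose_succ_succ' _ _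
      have := Nat.choose_pos (n := q + j + 2) (k := j) (by omega)
      omega
    · by_contra! hcon
      have h1 := Nat.choose_le_choose (j + 1) (show m + 1 ≤ q + j + 2 from hcon)
      omega
  subst hm
  rw [hm4, hN, Nat.sub_self, macaulayUp_zero_right, N, add_zero,
    show q + 2 + (j + 1 + 1) - 1 = q + j + 2 + 1 by omega]

theorem macaulayUp_of_le {i n : ℕ} (h : n ≤ i) : macaulayUp i n = n := by
  induction i generalizing n with
  | zero => simp [macaulayUp]; omega
  | succ i ih =>
    rcases Nat.eq_zero_or_pos n with rfl | hn
    · exact macaulayUp_zero_right _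
    · obtain ⟨m, hm1, hm2, hm3, hm4⟩ := exists_macaulayUp_succ (i := i) hn
      have hm : m = i + 1 := by
        by_contra hne
        have h1 := Nat.choose_le_choose (i + 1) (show i + 2 ≤ m by omega)
        have h2 : (i + 2).choose (i + 1) = i + 2 := Nat.choose_succ_self_right (i + 1)
        omega
      subst hm
      rw [hm4, Nat.choose_self, Nat.choose_self, ih (by omega)]
      omega

/-! ### The bound `H` -/

theorem derivBound_eq_add (r e : ℕ) (s : ℕ → ℕ) {i : ℕ} (hi : i ≤ e) :
    derivBound r e s i = s i + ∑ j ∈ Finset.range (e - i), N r (j + 1) * s (i + 1 + j) := by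
  rw [derivBound, show e + 1 - i = (e - i) + 1 by omega, Finset.sum_range_succ', N_zero]
  simp only [one_mul, add_zero]
  rw [add_comm]
  congr 1
  refine Finset.sum_congr rfl fun j _ => ?_
  rw [show i + (j + 1) = i + 1 + j by omega]

theorem derivBound_succ_le {r : ℕ} (hr : 0 < r) (e : ℕ) (s : ℕ → ℕ) (i : ℕ) :
    s i + derivBound r e s (i + 1) ≤ derivBound r e s i ∨ e < i := by
  rcases Nat.lt_or_ge e i with h | h
  · exact Or.inr h
  · left
    rw [derivBound_eq_add r e s h, derivBound, show e + 1 - (i + 1) = e - i by omega]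
    gcongr with j
    exact N_le_succ hr j

theorem derivBound_eq_zero {r e : ℕ} (s : ℕ → ℕ) {i : ℕ} (hi : e < i) :
    derivBound r e s i = 0 := by
  rw [derivBound, show e + 1 - i = 0 by omega]; simp

theorem derivBound_self (r e : ℕ) (s : ℕ → ℕ) : derivBound r e s e = s e := by
  rw [derivBound_eq_add r e s le_rfl]; simp

theorem N_le_derivBound {r e : ℕ} {s : ℕ → ℕ} (hse : 0 < s e) {i : ℕ} (hi : i ≤ e) :
    N r (e - i) ≤ derivBound r e s i := by
  refine le_trans ?_ (Finset.single_le_sum (f := fun j => N r j * s (i + j))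
    (fun _ _ => Nat.zero_le _) (Finset.mem_range.2 (show e - i < e + 1 - i by omega)))
  simp only [show i + (e - i) = e by omega]
  exact Nat.le_mul_of_pos_right _ hse

theorem derivBound_antitone {r : ℕ} (hr : 0 < r) (e : ℕ) (s : ℕ → ℕ) :
    Antitone (derivBound r e s) := by
  refine antitone_nat_of_succ_le fun i => ?_
  rcases derivBound_succ_le hr e s i with h | h
  · omega
  · rw [derivBound_eq_zero s (show e < i + 1 by omega)]; omega

theorem upperBound_eq_min (r e : ℕ) (s : ℕ → ℕ) {i : ℕ} (hi : 2 ≤ i) :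
    upperBound r e s i = min (growthTerm r e s i) (derivBound r e s i) := by
  obtain ⟨j, rfl⟩ : ∃ j, i = j + 2 := ⟨i - 2, by omega⟩
  simp [upperBound, growthTerm]

theorem growthTerm_succ (r e : ℕ) (s : ℕ → ℕ) {i : ℕ} (hi : 1 ≤ i) :
    growthTerm r e s (i + 1) = macaulayUp i (upperBound r e s i - s i) := by
  obtain ⟨j, rfl⟩ : ∃ j, i = j + 1 := ⟨i - 1, by omega⟩
  simp [growthTerm]

theorem upperBound_le_growthTerm (r e : ℕ) (s : ℕ → ℕ) (i : ℕ) :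
    upperBound r e s i ≤ growthTerm r e s i := by
  match i with
  | 0 => simp [upperBound, growthTerm]
  | 1 => simp [upperBound, growthTerm]
  | i + 2 => rw [upperBound_eq_min r e s (by omega)]; exact min_le_left _ _

theorem macaulayUp_le_N {r i n : ℕ} (hr : 1 < r) (hi : 0 < i) (h : n ≤ N r i) :
    macaulayUp i n ≤ N r (i + 1) := by
  rcases h.lt_or_eq with h | rfl
  · exact (macaulayUp_lt_N hr h).le
  · exact (macaulayUp_N hr hi).le

theorem upperBound_le_N {r : ℕ} (hr : 1 < r) (e : ℕ) (s : ℕ → ℕ) (i : ℕ) :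
    upperBound r e s i ≤ N r i := by
  induction i with
  | zero => simp [upperBound, N_zero]
  | succ i ih =>
    rcases Nat.eq_zero_or_pos i with rfl | hi
    · simp [upperBound, N_one]
    · refine (upperBound_le_growthTerm r e s _).trans ?_
      rw [growthTerm_succ r e s hi]
      exact macaulayUp_le_N hr hi (by omega)

/-- Below a degree in which `H` is generic, `H` is generic and the socle vanishes. -/
theorem generic_of_generic {r : ℕ} (hr : 1 < r) (e : ℕ) {s : ℕ → ℕ} (hs0 : s 0 = 0) {c : ℕ}
    (hc : upperBound r e s c = N r c) {i : ℕ} (hi : i < c) :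
    upperBound r e s i = N r i ∧ s i = 0 := by
  induction c with
  | zero => omega
  | succ c ih =>
    have key : upperBound r e s c = N r c ∧ s c = 0 := by
      rcases Nat.eq_zero_or_pos c with rfl | hc0
      · simp [upperBound, N_zero, hs0]
      · have h1 := upperBound_le_growthTerm r e s (c + 1)
        rw [hc, growthTerm_succ r e s hc0] at h1
        have h2 : N r c ≤ upperBound r e s c - s c := by
          by_contra! hcon
          exact absurd (macaulayUp_lt_N hr hcon) (by omega)
        have h3 := upperBound_le_N hr e s c
        have h4 := N_pos (show 0 < r by omega) c
        omega
    rcases Nat.lt_or_ge i c with h | h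
    · exact ih key.1 h
    · rwa [show i = c by omega]

/-- Beyond the last index of growth, `H` is the number of derivatives. -/
theorem upperBound_eq_derivBound {r e : ℕ} (hr : 1 < r) (he : 1 < e) {s : ℕ → ℕ}
    (hse : 0 < s e) {t : ℕ}
    (ht : IsLastGrowth r e s t) {i : ℕ} (hi : t < i) :
    upperBound r e s i = derivBound r e s i := by
  have h0 : e < i ∨ ¬ (upperBound r e s i = growthTerm r e s i ∧
      growthTerm r e s i < derivBound r e s i) := by
    by_contra! hcon
    have := ht.2 (show i ∈ {i | i ≤ e ∧ upperBound r e s i = growthTerm r e s i ∧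
      growthTerm r e s i < derivBound r e s i} from ⟨hcon.1, hcon.2.1, hcon.2.2⟩)
    omega
  rcases Nat.lt_or_ge i 2 with h2 | h2
  · obtain rfl : i = 1 := by omega
    have h1 : N r 1 ≤ derivBound r e s 1 :=
      (N_mono_right (by omega) (show 1 ≤ e - 1 by omega)).trans
        (N_le_derivBound hse (by omega))
    rw [N_one] at h1
    simp only [upperBound, growthTerm, true_and, not_lt] at h0 ⊢
    omega
  · rw [upperBound_eq_min r e s h2] at h0 ⊢
    rcases h0 with h0 | h0
    · rw [derivBound_eq_zero s h0]; simp
    · omega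

/-- If `h_c - s_c ≤ c`, the growth from degree `c` on is constant: each `h_{i+1}` is the smaller of
`h_i - s_i` and the number of derivatives. -/
theorem upperBound_succ_of_small {r e : ℕ} {s : ℕ → ℕ} {c : ℕ} (hc1 : 1 ≤ c)
    (hsmall : upperBound r e s c - s c ≤ c) {i : ℕ} (hi : c ≤ i) :
    upperBound r e s i - s i ≤ i ∧ growthTerm r e s (i + 1) = upperBound r e s i - s i ∧
    upperBound r e s (i + 1) = min (upperBound r e s i - s i) (derivBound r e s (i + 1)) := by
  have key : ∀ i, c ≤ i → upperBound r e s i - s i ≤ i →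
      growthTerm r e s (i + 1) = upperBound r e s i - s i ∧
      upperBound r e s (i + 1) =
        min (upperBound r e s i - s i) (derivBound r e s (i + 1)) := by
    intro i hi h
    have := growthTerm_succ r e s (show 1 ≤ i by omega)
    rw [macaulayUp_of_le h] at this
    exact ⟨this, by rw [upperBound_eq_min r e s (by omega), this]⟩
  suffices upperBound r e s i - s i ≤ i from ⟨this, key i hi this⟩
  induction i, hi using Nat.le_induction with
  | base => exact hsmall
  | succ i hi ih =>
    have := (key i hi ih).2
    omega

/-- In the range of constant growth, every index up to the last index of growth is one of
growth. -/
theorem upperBound_succ_of_small_of_lt {r e : ℕ} (hr : 0 < r) {s : ℕ → ℕ} {c t : ℕ} (hc1 : 1 ≤ c)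
    (hsmall : upperBound r e s c - s c ≤ c) (ht : IsLastGrowth r e s t) {i : ℕ} (hi : c ≤ i)
    (hit : i < t) : upperBound r e s (i + 1) = upperBound r e s i - s i := by
  have hte : t ≤ e := ht.1.1
  suffices h : ∀ d i, c ≤ i → i + 1 + d = t →
      upperBound r e s i - s i < derivBound r e s (i + 1) by
    have h1 := h (t - (i + 1)) i hi (by omega)
    have h2 := (upperBound_succ_of_small hc1 hsmall hi).2.2
    omega
  intro d
  induction d with
  | zero =>
    intro i hi hit
    have h1 := ht.1.2
    rw [← hit, add_zero] at h1
    have h2 := (upperBound_succ_of_small hc1 hsmall hi).2.1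
    omega
  | succ d ih =>
    intro i hi hit
    have h1 := ih (i + 1) (by omega) (by omega)
    have h2 := (upperBound_succ_of_small hc1 hsmall hi).2.2
    have h3 := derivBound_succ_le hr e s (i + 1)
    omega

section

/-! ### Shadows of sets of monomials -/

/-- If a set `B` of monomials of degree `d + 1` has its shadow contained in a set `W` of at most `d`
monomials, then `B` has at most as many elements as `W`. Only the variables in `S` matter: the
degree is counted, and the shadow taken, with respect to them. -/
theorem card_le_of_shadow_subset {σ : Type*} [DecidableEq σ] (S : Finset σ) (d : ℕ)
    (B W : Finset (σ →₀ ℕ)) (hB : ∀ b ∈ B, ∑ v ∈ S, b v = d + 1)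
    (hBW : ∀ b ∈ B, ∀ v ∈ S, 0 < b v → b - Finsupp.single v 1 ∈ W) (hW : W.card ≤ d) :
    B.card ≤ W.card := by
  induction S using Finset.induction_on generalizing d B W with
  | empty =>
    have : B = ∅ := Finset.eq_empty_of_forall_notMem fun b hb => by simpa using hB b hb
    simp [this]
  | insert x S hx ih =>
    set w : ℕ → ℕ := fun q => (W.filter fun a => a x = q).card with hw
    have hsum : ∀ p, ∑ q ∈ Finset.range p, w q = (W.filter fun a => a x < p).card := by
      intro p
      rw [Finset.card_eq_sum_card_fiberwise (f := fun a => a x) (t := Finset.range p)]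
      · refine Finset.sum_congr rfl fun q hq => ?_
        rw [Finset.filter_filter]
        refine congrArg Finset.card (Finset.ext fun a => ?_)
        simp only [Finset.mem_filter, Finset.mem_range] at hq ⊢
        constructor
        · rintro ⟨h1, h2⟩; exact ⟨h1, by omega, h2⟩
        · rintro ⟨h1, -, h2⟩; exact ⟨h1, h2⟩
      · intro a ha
        simpa using (Finset.mem_filter.1 ha).2
    -- Some exponent `p ≤ d` of `x` does not occur in `W`; the least one is taken.
    have hex : ∃ p, p ≤ d ∧ w p = 0 := by
      by_contra! hcon
      have h1 : ∑ q ∈ Finset.range (d + 1), 1 ≤ ∑ q ∈ Finset.range (d + 1), w q :=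
        Finset.sum_le_sum fun q hq => by
          have := hcon q (by simpa [Nat.lt_succ_iff] using hq)
          omega
      rw [hsum] at h1
      have := Finset.card_filter_le W fun a => a x < d + 1
      simp only [Finset.sum_const, smul_eq_mul, mul_one, Finset.card_range] at h1
      omega
    classical
    set p := Nat.find hex
    obtain ⟨hpd, hp0⟩ : p ≤ d ∧ w p = 0 := Nat.find_spec hex
    have hpmin : ∀ q < p, 1 ≤ w q := fun q hq => by
      have := Nat.find_min hex hq
      have : w q ≠ 0 := fun h => this ⟨by omega, h⟩
      omega
    have hslice : ∀ b ∈ B, ∀ v ∈ S, 0 < b v →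
        b - Finsupp.single v 1 ∈ W.filter fun a => a x = b x := fun b hb v hv hbv => by
      refine Finset.mem_filter.2 ⟨hBW b hb v (Finset.mem_insert_of_mem hv) hbv, ?_⟩
      have : v ≠ x := fun h => hx (h ▸ hv)
      simp [this]
    have hdeg : ∀ b ∈ B, b x + ∑ v ∈ S, b v = d + 1 := fun b hb => by
      rw [← hB b hb, Finset.sum_insert hx]
    have hBp : ∀ b ∈ B, b x ≠ p := fun b hb hbp => by
      have h1 := hdeg b hb
      obtain ⟨v, hv, hbv⟩ : ∃ v ∈ S, b v ≠ 0 := by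
        by_contra! hcon
        rw [Finset.sum_eq_zero hcon] at h1
        omega
      have h2 := hslice b hb v hv (by omega)
      rw [hbp, Finset.card_eq_zero.1 hp0] at h2
      simp at h2
    have hlow : (B.filter fun b => b x < p).card ≤ (W.filter fun a => a x < p).card := by
      rw [← hsum, Finset.card_eq_sum_card_fiberwise (f := fun a => a x) (t := Finset.range p)
        (fun a ha => by simpa using (Finset.mem_filter.1 ha).2)]
      refine Finset.sum_le_sum fun q hq => ?_
      have hq := Finset.mem_range.1 hq
      refine ih (d - q) _ _ (fun b hb => ?_) (fun b hb v hv hbv => ?_) ?_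
      · obtain ⟨hb, hbq⟩ := Finset.mem_filter.1 hb
        have := hdeg b (Finset.mem_filter.1 hb).1
        omega
      · obtain ⟨hb, hbq⟩ := Finset.mem_filter.1 hb
        have := hslice b (Finset.mem_filter.1 hb).1 v hv hbv
        rwa [hbq] at this
      · -- The other `p - 1` slices below `p` are nonempty, so this one has at most `d - p + 1`
        -- elements.
        have h1 : ∑ q' ∈ (Finset.range p).erase q, 1 ≤ ∑ q' ∈ (Finset.range p).erase q, w q' :=
          Finset.sum_le_sum fun q' hq' =>
            hpmin q' (Finset.mem_range.1 (Finset.mem_of_mem_erase hq'))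
        have h2 := Finset.add_sum_erase (Finset.range p) w (Finset.mem_range.2 hq)
        rw [hsum] at h2
        have h3 := Finset.card_filter_le W fun a => a x < p
        have h4 := Finset.card_erase_of_mem (Finset.mem_range.2 hq)
        simp only [Finset.sum_const, smul_eq_mul, mul_one, h4, Finset.card_range] at h1
        change w q ≤ d - q
        omega
    have hhigh : (B.filter fun b => ¬ b x < p).card ≤ (W.filter fun a => ¬ a x < p).card := by
      have hpos : ∀ b ∈ B.filter fun b => ¬ b x < p, b ∈ B ∧ p < b x := fun b hb => by
        obtain ⟨hb, hbp⟩ := Finset.mem_filter.1 hb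
        have := hBp b hb
        exact ⟨hb, by omega⟩
      refine Finset.card_le_card_of_injOn (fun b => b - Finsupp.single x 1) (fun b hb => ?_) ?_
      · obtain ⟨hb, hbp⟩ := hpos b hb
        refine Finset.mem_coe.2 (Finset.mem_filter.2
          ⟨hBW b hb x (Finset.mem_insert_self _ _) (by omega), ?_⟩)
        simp
        omega
      · intro b hb b' hb' h
        have h1 := (hpos b hb).2
        have h2 := (hpos b' hb').2
        have hle : ∀ a : σ →₀ ℕ, p < a x → Finsupp.single x 1 ≤ a := fun a ha => by
          rw [Finsupp.single_le_iff]; omega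
        have h3 := tsub_add_cancel_of_le (hle b h1)
        rw [← h3, show b - Finsupp.single x 1 = b' - Finsupp.single x 1 from h,
          tsub_add_cancel_of_le (hle b' h2)]
    have h1 := Finset.card_filter_add_card_filter_not (s := B) (fun b => b x < p)
    have h2 := Finset.card_filter_add_card_filter_not (s := W) (fun b => b x < p)
    omega

/-! ### Monomials of a given degree -/

/-- The exponents of the monomials of degree `d` in `r` variables. -/
def monos (r d : ℕ) : Finset (Fin r →₀ ℕ) := Finset.finsuppAntidiag Finset.univ d

theorem mem_monos {r d : ℕ} {a : Fin r →₀ ℕ} : a ∈ monos r d ↔ a.degree = d := by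
  simp [monos, Finset.mem_finsuppAntidiag, Finsupp.degree_eq_sum]

theorem card_monos (r d : ℕ) : (monos r d).card = N r d := by
  simp [monos, Finset.card_finsuppAntidiag_nat_eq_choose, N]

open MvPolynomial

variable {k : Type*} [Field k] {r : ℕ}

theorem monomial_mem_homogeneousSubmodule {d : ℕ} {a : Fin r →₀ ℕ} (ha : a ∈ monos r d) (x : k) :
    monomial a x ∈ homogeneousSubmodule (Fin r) k d :=
  isHomogeneous_monomial x (mem_monos.1 ha)

theorem homogeneousSubmodule_eq_span (d : ℕ) : homogeneousSubmodule (Fin r) k d =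
    Submodule.span k ((fun a => monomial a (1 : k)) '' (monos r d : Set (Fin r →₀ ℕ))) := by
  apply le_antisymm
  · intro f hf
    rw [f.as_sum]
    refine Submodule.sum_mem _ fun a ha => ?_
    rw [show monomial a (coeff a f) = coeff a f • monomial a (1 : k) by
      rw [smul_monomial, smul_eq_mul, mul_one]]
    refine Submodule.smul_mem _ _ (Submodule.subset_span ⟨a, ?_, rfl⟩)
    have h1 : IsHomogeneous f d := hf
    exact Finset.mem_coe.2 (mem_monos.2 (by
      by_contra h2
      exact (mem_support_iff.1 ha) (h1.coeff_eq_zero h2)))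
  · rw [Submodule.span_le]
    rintro - ⟨a, ha, rfl⟩
    exact monomial_mem_homogeneousSubmodule ha 1

instance finite_homogeneousSubmodule (d : ℕ) :
    Module.Finite k (homogeneousSubmodule (Fin r) k d) :=
  Module.Finite.iff_fg.2 (homogeneousSubmodule_fg _ _ d)

theorem linearIndependent_monomial :
    LinearIndependent k fun a : Fin r →₀ ℕ => monomial a (1 : k) :=
  (basisMonomials (Fin r) k).linearIndependent

theorem finrank_homogeneousSubmodule (d : ℕ) :
    Module.finrank k (homogeneousSubmodule (Fin r) k d) = N r d := by
  classical
  have h := (linearIndependent_monomial (k := k) (r := r)).comp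
    (fun a : monos r d => a.1) Subtype.val_injective
  have h2 := finrank_span_eq_card h
  rw [Fintype.card_coe, card_monos] at h2
  rw [← h2, homogeneousSubmodule_eq_span, Set.image_eq_range]
  rfl

/-! ### Quotients of small dimension do not grow -/

/-- The monomials of degree `d` that are not leading monomials (for the lexicographic order) of
forms of degree `d` in `V`. -/
noncomputable def standardMonos (V : Submodule k (MvPolynomial (Fin r) k)) (d : ℕ) :
    Finset (Fin r →₀ ℕ) := by
  classical
  exact (monos r d).filter fun a => ¬ ∃ f ∈ V, f ∈ homogeneousSubmodule (Fin r) k d ∧ f ≠ 0 ∧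
    MonomialOrder.lex.degree f = a

theorem mem_standardMonos {V : Submodule k (MvPolynomial (Fin r) k)} {d : ℕ} {a : Fin r →₀ ℕ} :
    a ∈ standardMonos V d ↔ a ∈ monos r d ∧ ∀ f ∈ V, f ∈ homogeneousSubmodule (Fin r) k d →
      f ≠ 0 → MonomialOrder.lex.degree f ≠ a := by
  classical
  simp [standardMonos]

theorem card_standardMonos_le (V : Submodule k (MvPolynomial (Fin r) k)) (d : ℕ) :
    (standardMonos V d).card ≤
      Module.finrank k ((homogeneousSubmodule (Fin r) k d).map V.mkQ) := by
  classical
  have hli : LinearIndependent k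
      fun a : standardMonos V d => V.mkQ (monomial a.1 (1 : k)) := by
    rw [Fintype.linearIndependent_iff]
    intro g hg
    set f : MvPolynomial (Fin r) k := ∑ a, g a • monomial a.1 (1 : k) with hf
    have hcoeff : ∀ a : standardMonos V d, coeff a.1 f = g a := fun a => by
      rw [hf, coeff_sum, Finset.sum_eq_single a]
      · simp [coeff_smul]
      · intro b _ hb
        have : b.1 ≠ a.1 := fun h => hb (Subtype.ext h)
        simp [coeff_smul, coeff_monomial, this]
      · simp
    have hcoeff' : ∀ a ∉ standardMonos V d, coeff a f = 0 := fun a ha => by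
      rw [hf, coeff_sum]
      refine Finset.sum_eq_zero fun b _ => ?_
      have : b.1 ≠ a := fun h => ha (h ▸ b.2)
      simp [coeff_smul, coeff_monomial, this]
    have hfV : f ∈ V := by
      rw [← Submodule.Quotient.mk_eq_zero, ← Submodule.mkQ_apply, hf, map_sum]
      simpa using hg
    have hfd : f ∈ homogeneousSubmodule (Fin r) k d :=
      Submodule.sum_mem _ fun a _ => Submodule.smul_mem _ _
        (monomial_mem_homogeneousSubmodule (mem_standardMonos.1 a.2).1 1)
    have hf0 : f = 0 := by
      by_contra hf0
      have h1 := (MonomialOrder.lex (σ := Fin r)).degree_mem_support hf0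
      have h2 : MonomialOrder.lex.degree f ∈ standardMonos V d := by
        by_contra hcon
        exact mem_support_iff.1 h1 (hcoeff' _ hcon)
      exact (mem_standardMonos.1 h2).2 f hfV hfd hf0 rfl
    intro a
    rw [← hcoeff a, hf0, coeff_zero]
  have h := finrank_span_eq_card hli
  rw [Fintype.card_coe] at h
  rw [← h]
  refine Submodule.finrank_mono ?_
  rw [Submodule.span_le]
  rintro - ⟨a, rfl⟩
  exact Submodule.mem_map_of_mem
    (monomial_mem_homogeneousSubmodule (mem_standardMonos.1 a.2).1 1)

theorem finrank_le_card_standardMonos (V : Submodule k (MvPolynomial (Fin r) k)) (d : ℕ) :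
    Module.finrank k ((homogeneousSubmodule (Fin r) k d).map V.mkQ) ≤
      (standardMonos V d).card := by
  classical
  set U := Submodule.span k (((standardMonos V d).image
    fun a => V.mkQ (monomial a (1 : k)) : Finset _) : Set (MvPolynomial (Fin r) k ⧸ V)) with hU
  have hmon : ∀ n : MonomialOrder.lex.syn (σ := Fin r), ∀ a : Fin r →₀ ℕ,
      MonomialOrder.lex.toSyn a = n → a ∈ monos r d → V.mkQ (monomial a (1 : k)) ∈ U := by
    intro n
    induction n using WellFoundedLT.induction with
    | ind n ih =>
      rintro a rfl ha
      by_cases has : a ∈ standardMonos V d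
      · exact Submodule.subset_span (by
          simpa using ⟨a, has, rfl⟩)
      · rw [mem_standardMonos] at has
        push Not at has
        obtain ⟨f, hfV, hfd, hf0, rfl⟩ := has ha
        set a := MonomialOrder.lex.degree f with ha'
        have hsupp := (MonomialOrder.lex (σ := Fin r)).degree_mem_support hf0
        have h1 : V.mkQ f = 0 := by simpa using hfV
        rw [f.as_sum, ← Finset.add_sum_erase _ _ hsupp, map_add] at h1
        have h2 : V.mkQ (monomial a (coeff a f)) ∈ U := by
          rw [eq_neg_of_add_eq_zero_left h1, map_sum]
          refine Submodule.neg_mem _ (Submodule.sum_mem _ fun b hb => ?_)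
          obtain ⟨hba, hb⟩ := Finset.mem_erase.1 hb
          have hle := (MonomialOrder.lex (σ := Fin r)).le_degree hb
          have hlt := lt_of_le_of_ne hle fun h =>
            hba (MonomialOrder.lex.toSyn.injective h)
          have hbm : b ∈ monos r d := mem_monos.2 (by
            by_contra h3
            exact mem_support_iff.1 hb ((show IsHomogeneous f d from hfd).coeff_eq_zero h3))
          have h4 := U.smul_mem (coeff b f) (ih _ hlt b rfl hbm)
          rwa [← map_smul, smul_monomial, smul_eq_mul, mul_one] at h4
        have h5 := U.smul_mem (coeff a f)⁻¹ h2
        rwa [← map_smul, smul_monomial, smul_eq_mul,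
          inv_mul_cancel₀ (mem_support_iff.1 hsupp)] at h5
  have hle : (homogeneousSubmodule (Fin r) k d).map V.mkQ ≤ U := by
    rw [homogeneousSubmodule_eq_span, Submodule.map_span, Submodule.span_le]
    rintro - ⟨-, ⟨a, ha, rfl⟩, rfl⟩
    exact hmon _ a rfl ha
  refine (Submodule.finrank_mono hle).trans ?_
  rw [hU]
  exact (finrank_span_finset_le_card _).trans Finset.card_image_le

/-- Macaulay's bound in the range where it says that the dimension does not grow: if the forms of
degree `d` modulo `V` have dimension at most `d`, then the forms of degree `d + 1` modulo a space
containing all `x_v V` have no larger dimension. -/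
theorem finrank_succ_le_of_finrank_le {V V' : Submodule k (MvPolynomial (Fin r) k)} {d : ℕ}
    (hVV' : ∀ f ∈ V, ∀ v, X v * f ∈ V')
    (hd : Module.finrank k ((homogeneousSubmodule (Fin r) k d).map V.mkQ) ≤ d) :
    Module.finrank k ((homogeneousSubmodule (Fin r) k (d + 1)).map V'.mkQ) ≤
      Module.finrank k ((homogeneousSubmodule (Fin r) k d).map V.mkQ) := by
  classical
  refine (finrank_le_card_standardMonos V' (d + 1)).trans
    (le_trans ?_ (card_standardMonos_le V d))
  refine card_le_of_shadow_subset Finset.univ d _ _ (fun b hb => ?_) (fun b hb v _ hbv => ?_)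
    ((card_standardMonos_le V d).trans hd)
  · rw [← Finsupp.degree_eq_sum]
    exact mem_monos.1 (mem_standardMonos.1 hb).1
  · obtain ⟨hb1, hb2⟩ := mem_standardMonos.1 hb
    have hle : Finsupp.single v 1 ≤ b := by rw [Finsupp.single_le_iff]; omega
    have hcancel := add_tsub_cancel_of_le hle
    rw [mem_standardMonos]
    constructor
    · rw [mem_monos] at hb1 ⊢
      rw [← hcancel, map_add, Finsupp.degree_single] at hb1
      omega
    · intro f hf hfd hf0 hfb
      refine hb2 (X v * f) (hVV' f hf v) ?_ (mul_ne_zero (X_ne_zero v) hf0) ?_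
      · have := (isHomogeneous_X k v).mul (show IsHomogeneous f d from hfd)
        rwa [add_comm] at this
      · rw [MonomialOrder.degree_mul (X_ne_zero v) hf0, MonomialOrder.degree_X, hfb, hcancel]

end

section

/-! ### Dimensions of graded pieces and of the socle -/

section LinearAlgebra

variable {k : Type*} [Field k] {E F G : Type*} [AddCommGroup E] [Module k E] [AddCommGroup F]
  [Module k F] [AddCommGroup G] [Module k G]

theorem finrank_map_add_finrank_inf_ker (p : Submodule k E) [Module.Finite k p] (f : E →ₗ[k] F) :
    Module.finrank k (p.map f) + Module.finrank k (p ⊓ LinearMap.ker f : Submodule k E) =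
      Module.finrank k p := by
  rw [← (f.domRestrict p).finrank_range_add_finrank_ker, LinearMap.range_domRestrict,
    LinearMap.ker_domRestrict, ← Submodule.map_comap_subtype, Submodule.finrank_map_subtype_eq]

theorem finrank_map_eq_of_ker (p : Submodule k E) [Module.Finite k p] {f : E →ₗ[k] F}
    {g : E →ₗ[k] G} (h : ∀ x ∈ p, f x = 0 ↔ g x = 0) :
    Module.finrank k (p.map f) = Module.finrank k (p.map g) := by
  have h1 := finrank_map_add_finrank_inf_ker p f
  have h2 := finrank_map_add_finrank_inf_ker p g
  have h3 : p ⊓ LinearMap.ker f = p ⊓ LinearMap.ker g := by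
    ext x
    simp only [Submodule.mem_inf, LinearMap.mem_ker]
    exact and_congr_right (h x)
  rw [h3] at h1
  omega

theorem finrank_map_inf_ker_add (p : Submodule k E) [Module.Finite k p] {f : E →ₗ[k] F}
    {g : E →ₗ[k] G} (h : ∀ x ∈ p, f x = 0 → g x = 0) :
    Module.finrank k ((p ⊓ LinearMap.ker g).map f) + Module.finrank k (p.map g) =
      Module.finrank k (p.map f) := by
  have h1 := finrank_map_add_finrank_inf_ker p f
  have h2 := finrank_map_add_finrank_inf_ker p g
  have : Module.Finite k (p ⊓ LinearMap.ker g : Submodule k E) :=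
    Submodule.finiteDimensional_inf_left _ _
  have h3 := finrank_map_add_finrank_inf_ker (p ⊓ LinearMap.ker g) f
  have h4 : p ⊓ LinearMap.ker g ⊓ LinearMap.ker f = p ⊓ LinearMap.ker f := by
    ext x
    simp only [Submodule.mem_inf, LinearMap.mem_ker]
    constructor
    · rintro ⟨⟨a, b⟩, c⟩; exact ⟨a, c⟩
    · rintro ⟨a, c⟩; exact ⟨⟨a, h x a c⟩, c⟩
  rw [h4] at h3
  omega

end LinearAlgebra

open MvPolynomial

variable {k : Type*} [Field k] {r : ℕ}

/-- The polynomials all of whose products with the variables lie in `K`. -/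
noncomputable def colon (K : Submodule k (MvPolynomial (Fin r) k)) :
    Submodule k (MvPolynomial (Fin r) k) :=
  ⨅ v : Fin r, K.comap (LinearMap.mulLeft k (X v))

theorem mem_colon {K : Submodule k (MvPolynomial (Fin r) k)} {f : MvPolynomial (Fin r) k} :
    f ∈ colon K ↔ ∀ v, X v * f ∈ K := by
  simp [colon]

theorem finrank_gradedPiece (I : Ideal (MvPolynomial (Fin r) k)) (i : ℕ) :
    Module.finrank k (gradedPiece I i) =
      Module.finrank k ((homogeneousSubmodule (Fin r) k i).map (I.restrictScalars k).mkQ) :=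
  finrank_map_eq_of_ker _ fun f _ => by
    simp [Ideal.Quotient.eq_zero_iff_mem]

theorem mk_mem_socle {I : Ideal (MvPolynomial (Fin r) k)} {f : MvPolynomial (Fin r) k} :
    Ideal.Quotient.mk I f ∈ socle I ↔ f ∈ colon (I.restrictScalars k) := by
  rw [socle, mem_colon, Ideal.span, Submodule.mem_annihilator_span]
  simp only [Subtype.forall, Set.forall_mem_range, smul_eq_mul, ← map_mul,
    Ideal.Quotient.eq_zero_iff_mem, Submodule.restrictScalars_mem, mul_comm f]

theorem soclePiece_eq (I : Ideal (MvPolynomial (Fin r) k)) (i : ℕ) :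
    soclePiece I i = (homogeneousSubmodule (Fin r) k i ⊓
      LinearMap.ker (colon (I.restrictScalars k)).mkQ).map
        (Ideal.Quotient.mkₐ k I).toLinearMap := by
  ext a
  simp only [soclePiece, gradedPiece, Submodule.mem_inf, Submodule.mem_map, Submodule.ker_mkQ,
    Submodule.restrictScalars_mem]
  constructor
  · rintro ⟨h1, f, hf, rfl⟩
    exact ⟨f, ⟨hf, mk_mem_socle.1 h1⟩, rfl⟩
  · rintro ⟨f, ⟨hf, h1⟩, rfl⟩
    exact ⟨mk_mem_socle.2 h1, f, hf, rfl⟩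

/-- The dimension of the socle in degree `i` is that of `A_i` minus the codimension of the space of
forms of degree `i` that the variables multiply into `I`. -/
theorem finrank_soclePiece_add (I : Ideal (MvPolynomial (Fin r) k)) (i : ℕ) :
    Module.finrank k (soclePiece I i) + Module.finrank k
      ((homogeneousSubmodule (Fin r) k i).map (colon (I.restrictScalars k)).mkQ) =
      Module.finrank k (gradedPiece I i) := by
  rw [soclePiece_eq]
  refine finrank_map_inf_ker_add _ fun f _ hf => ?_
  have hf : f ∈ I := Ideal.Quotient.eq_zero_iff_mem.1 hf
  rw [Submodule.mkQ_apply, Submodule.Quotient.mk_eq_zero, mem_colon]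
  exact fun v => I.mul_mem_left _ hf

theorem homogeneousComponent_succ_X_mul (v : Fin r) (f : MvPolynomial (Fin r) k) (i : ℕ) :
    homogeneousComponent (i + 1) (X v * f) = X v * homogeneousComponent i f := by
  classical
  ext m
  rw [coeff_homogeneousComponent, coeff_X_mul', coeff_X_mul', coeff_homogeneousComponent]
  by_cases hv : v ∈ m.support
  · have hle : Finsupp.single v 1 ≤ m := by
      rw [Finsupp.single_le_iff]; have := Finsupp.mem_support_iff.1 hv; omega
    have h : m.degree = 1 + (m - Finsupp.single v 1).degree := by
      conv_lhs => rw [← add_tsub_cancel_of_le hle, map_add, Finsupp.degree_single]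
    rw [if_pos hv, if_pos hv, h]
    simp only [show 1 + (m - Finsupp.single v 1).degree = i + 1 ↔
      (m - Finsupp.single v 1).degree = i by omega]
  · simp [hv]

theorem homogeneousComponent_zero_X_mul (v : Fin r) (f : MvPolynomial (Fin r) k) :
    homogeneousComponent 0 (X v * f) = 0 := by
  classical
  simp [homogeneousComponent_zero, coeff_X_mul']

/-- The ideal whose forms of degree `i` are those in `K i`. -/
noncomputable def idealOfFamily (K : ℕ → Submodule k (MvPolynomial (Fin r) k))
    (hK : ∀ i v, ∀ f ∈ homogeneousSubmodule (Fin r) k i, f ∈ K i → X v * f ∈ K (i + 1)) :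
    Ideal (MvPolynomial (Fin r) k) where
  carrier := {f | ∀ i, homogeneousComponent i f ∈ K i}
  add_mem' ha hb i := by rw [map_add]; exact (K i).add_mem (ha i) (hb i)
  zero_mem' i := by rw [map_zero]; exact (K i).zero_mem
  smul_mem' p f hf := by
    rw [smul_eq_mul]
    induction p using MvPolynomial.induction_on with
    | C a =>
      intro i
      rw [homogeneousComponent_C_mul, ← smul_eq_C_mul]
      exact (K i).smul_mem a (hf i)
    | add p q hp hq =>
      intro i
      rw [add_mul, map_add]
      exact (K i).add_mem (hp i) (hq i)
    | mul_X p v hp =>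
      intro i
      rw [mul_comm p, mul_assoc]
      cases i with
      | zero => rw [homogeneousComponent_zero_X_mul]; exact (K 0).zero_mem
      | succ i =>
        rw [homogeneousComponent_succ_X_mul]
        exact hK i v _ (homogeneousComponent_mem i _) (hp i)

theorem mem_idealOfFamily {K : ℕ → Submodule k (MvPolynomial (Fin r) k)}
    (hK : ∀ i v, ∀ f ∈ homogeneousSubmodule (Fin r) k i, f ∈ K i → X v * f ∈ K (i + 1))
    {i : ℕ} {f : MvPolynomial (Fin r) k} (hf : f ∈ homogeneousSubmodule (Fin r) k i) :
    f ∈ idealOfFamily K hK ↔ f ∈ K i := by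
  change (∀ j, homogeneousComponent j f ∈ K j) ↔ _
  constructor
  · intro h
    simpa [homogeneousComponent_of_mem hf] using h i
  · intro h j
    rw [homogeneousComponent_of_mem hf]
    split_ifs with hij
    · rwa [hij]
    · exact (K j).zero_mem

attribute [local instance] MvPolynomial.gradedAlgebra

theorem isHomogeneous_idealOfFamily {K : ℕ → Submodule k (MvPolynomial (Fin r) k)}
    (hK : ∀ i v, ∀ f ∈ homogeneousSubmodule (Fin r) k i, f ∈ K i → X v * f ∈ K (i + 1)) :
    (idealOfFamily K hK).IsHomogeneous (homogeneousSubmodule (Fin r) k) := by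
  intro i f hf
  have h : (DirectSum.decompose (homogeneousSubmodule (Fin r) k) f i : MvPolynomial (Fin r) k) =
      homogeneousComponent i f := decomposition.decompose'_apply f i
  rw [h, mem_idealOfFamily hK (homogeneousComponent_mem i f)]
  exact hf i

theorem finite_quotient {I : Ideal (MvPolynomial (Fin r) k)} {e : ℕ}
    (hI : ∀ i, e < i → homogeneousSubmodule (Fin r) k i ≤ I.restrictScalars k) :
    Module.Finite k (MvPolynomial (Fin r) k ⧸ I) := by
  have hfg : (⨆ i ∈ Finset.range (e + 1), gradedPiece I i).FG :=
    Submodule.fg_biSup _ _ fun i _ => (homogeneousSubmodule_fg _ _ i).map _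
  have htop : (⨆ i ∈ Finset.range (e + 1), gradedPiece I i) = ⊤ := by
    rw [eq_top_iff]
    rintro a -
    obtain ⟨f, rfl⟩ := Ideal.Quotient.mk_surjective a
    rw [← sum_homogeneousComponent f, map_sum]
    refine Submodule.sum_mem _ fun i _ => ?_
    rcases Nat.lt_or_ge e i with hi | hi
    · rw [Ideal.Quotient.eq_zero_iff_mem.2 (hI i hi (homogeneousComponent_mem i f))]
      exact Submodule.zero_mem _
    · exact Submodule.mem_iSup_of_mem i (Submodule.mem_iSup_of_mem
        (Finset.mem_range.2 (by omega)) ⟨_, homogeneousComponent_mem i f, rfl⟩)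
  rw [htop] at hfg
  exact Module.finite_def.2 hfg

/-- Admissibility from a family of spaces of forms that is closed under multiplication by the
variables. -/
theorem admissible_of_family {K : ℕ → Submodule k (MvPolynomial (Fin r) k)} {s h : ℕ → ℕ} {e : ℕ}
    (hK : ∀ i v, ∀ f ∈ homogeneousSubmodule (Fin r) k i, f ∈ K i → X v * f ∈ K (i + 1))
    (htop : ∀ i, e < i → homogeneousSubmodule (Fin r) k i ≤ K i) (h1 : h 1 = r)
    (hh : ∀ i, Module.finrank k ((homogeneousSubmodule (Fin r) k i).map (K i).mkQ) = h i)
    (hs : ∀ i, s i + Module.finrank k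
      ((homogeneousSubmodule (Fin r) k i).map (colon (K (i + 1))).mkQ) = h i) :
    Admissible k r s h := by
  have hgr : ∀ i, Module.finrank k (gradedPiece (idealOfFamily K hK) i) = h i := fun i => by
    rw [finrank_gradedPiece, ← hh i]
    refine finrank_map_eq_of_ker _ fun f hf => ?_
    simpa using mem_idealOfFamily hK hf
  have hfin : Module.Finite k (MvPolynomial (Fin r) k ⧸ idealOfFamily K hK) :=
    finite_quotient (e := e) fun i hi f hf => (mem_idealOfFamily hK hf).2 (htop i hi hf)
  refine ⟨idealOfFamily K hK, isHomogeneous_idealOfFamily hK, IsArtinianRing.of_finite k _,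
    (hgr 1).trans h1, fun i => ?_, hgr⟩
  have h2 := finrank_soclePiece_add (idealOfFamily K hK) i
  have h3 : Module.finrank k ((homogeneousSubmodule (Fin r) k i).map
      (colon ((idealOfFamily K hK).restrictScalars k)).mkQ) =
      Module.finrank k ((homogeneousSubmodule (Fin r) k i).map (colon (K (i + 1))).mkQ) := by
    refine finrank_map_eq_of_ker _ fun f hf => ?_
    simp only [Submodule.mkQ_apply, Submodule.Quotient.mk_eq_zero, mem_colon,
      Submodule.restrictScalars_mem]
    refine forall_congr' fun v => mem_idealOfFamily hK ?_
    have := (isHomogeneous_X k v).mul (show IsHomogeneous f i from hf)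
    rwa [add_comm] at this
  have h4 := hs i
  rw [h3, hgr] at h2
  omega

/-- Macaulay's bound for an algebra with a socle, in the range where it says that the dimension does
not grow. -/
theorem HasData.succ_le {I : Ideal (MvPolynomial (Fin r) k)} {s h : ℕ → ℕ} (hI : HasData I s h)
    {i : ℕ} (hi : h i ≤ s i + i) : s i + h (i + 1) ≤ h i := by
  have h1 := finrank_soclePiece_add I i
  rw [hI.socleVector, hI.hVector] at h1
  have h2 := finrank_succ_le_of_finrank_le (V := colon (I.restrictScalars k))
    (V' := I.restrictScalars k) (d := i) (fun f hf v => mem_colon.1 hf v) (by omega)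
  rw [← finrank_gradedPiece, hI.hVector] at h2
  omega

theorem HasData.le_N {I : Ideal (MvPolynomial (Fin r) k)} {s h : ℕ → ℕ} (hI : HasData I s h)
    (i : ℕ) : h i ≤ N r i := by
  rw [← hI.hVector, ← finrank_homogeneousSubmodule (k := k)]
  exact Submodule.finrank_map_le _ _

theorem HasData.socle_le {I : Ideal (MvPolynomial (Fin r) k)} {s h : ℕ → ℕ} (hI : HasData I s h)
    (i : ℕ) : s i ≤ h i := by
  have h1 := finrank_soclePiece_add I i
  rw [hI.socleVector, hI.hVector] at h1
  omega

end

section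

open MvPolynomial

/-! ### Multiplicatively independent nodes -/

theorem factorization_prod_nth_prime {n : ℕ} (γ : ℕ → ℕ) {i : ℕ} (hi : i < n) :
    (∏ j ∈ Finset.range n, Nat.nth Nat.Prime j ^ γ j).factorization (Nat.nth Nat.Prime i) =
      γ i := by
  rw [Nat.factorization_prod fun j _ => pow_ne_zero _ (Nat.prime_nth_prime j).ne_zero,
    Finsupp.finsetSum_apply, Finset.sum_eq_single i]
  · rw [(Nat.prime_nth_prime i).factorization_pow, Finsupp.single_eq_same]
  · intro j _ hj
    rw [(Nat.prime_nth_prime j).factorization_pow, Finsupp.single_eq_of_ne]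
    exact fun h => hj (Nat.nth_injective Nat.infinite_setOfPred_prime h).symm
  · intro h
    exact absurd (Finset.mem_range.2 hi) h

variable {k : Type*} [Field k] {r : ℕ}

/-- In characteristic zero there are a point `z` with nonzero coordinates and scalars `u_{j,m}` such
that the numbers `z^a u_{j,m}` are pairwise distinct: powers of distinct primes. -/
theorem exists_nodes [CharZero k] (r : ℕ) : ∃ (z : Fin r → k) (u : ℕ → ℕ → k),
    (∀ v, z v ≠ 0) ∧
    Function.Injective fun x : Σ _ : ℕ, ℕ × (Fin r →₀ ℕ) =>
      eval z (monomial x.2.2 1) * u x.1 x.2.1 := by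
  have hp : ∀ i, (Nat.nth Nat.Prime i : k) ≠ 0 := fun i =>
    Nat.cast_ne_zero.2 (Nat.prime_nth_prime i).ne_zero
  refine ⟨fun v => Nat.nth Nat.Prime v,
    fun j m => Nat.nth Nat.Prime r ^ j * Nat.nth Nat.Prime (r + 1) ^ m, fun v => hp v, ?_⟩
  set γ : (Σ _ : ℕ, ℕ × (Fin r →₀ ℕ)) → ℕ → ℕ := fun x i =>
    if h : i < r then x.2.2 ⟨i, h⟩ else if i = r then x.1 else x.2.1 with hγ
  have hval : ∀ x : Σ _ : ℕ, ℕ × (Fin r →₀ ℕ),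
      eval (fun v : Fin r => (Nat.nth Nat.Prime v : k)) (monomial x.2.2 1) *
        ((Nat.nth Nat.Prime r : k) ^ x.1 * (Nat.nth Nat.Prime (r + 1) : k) ^ x.2.1) =
      ((∏ j ∈ Finset.range (r + 2), Nat.nth Nat.Prime j ^ γ x j : ℕ) : k) := by
    intro x
    rw [Finset.prod_range_succ, Finset.prod_range_succ, ← Fin.prod_univ_eq_prod_range
      (fun j => Nat.nth Nat.Prime j ^ γ x j), eval_monomial, one_mul,
      Finsupp.prod_fintype _ _ fun _ => pow_zero _]
    simp [hγ, mul_assoc]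
  rintro x y hxy
  simp only [hval] at hxy
  have hxy := Nat.cast_injective hxy
  have hγxy : ∀ i < r + 2, γ x i = γ y i := fun i hi => by
    rw [← factorization_prod_nth_prime (γ x) hi, hxy, factorization_prod_nth_prime (γ y) hi]
  have h1 := hγxy r (by omega)
  have h2 := hγxy (r + 1) (by omega)
  have h3 : ∀ v : Fin r, x.2.2 v = y.2.2 v := fun v => by
    simpa [hγ] using hγxy v (by omega)
  obtain ⟨xj, xm, xa⟩ := x
  obtain ⟨yj, ym, ya⟩ := y
  simp only [hγ, lt_irrefl, dite_false, if_true] at h1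
  simp [hγ] at h2
  obtain rfl := h1
  obtain rfl := h2
  obtain rfl : xa = ya := Finsupp.ext h3
  rfl

/-! ### Evaluation at points and generic combinations of evaluations -/

/-- Evaluation at the points `z^0, …, z^(n-1)`, the powers being taken coordinatewise. -/
noncomputable def evalPoints (z : Fin r → k) (n : ℕ) :
    MvPolynomial (Fin r) k →ₗ[k] (Fin n → k) :=
  LinearMap.pi fun l => (aeval fun v => z v ^ (l : ℕ)).toLinearMap

theorem evalPoints_apply (z : Fin r → k) (n : ℕ) (f : MvPolynomial (Fin r) k) (l : Fin n) :
    evalPoints z n f l = eval (fun v => z v ^ (l : ℕ)) f := by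
  simp [evalPoints, aeval_eq_eval]

theorem eval_pow_monomial (z : Fin r → k) (a : Fin r →₀ ℕ) (l : ℕ) :
    eval (fun v => z v ^ l) (monomial a (1 : k)) = eval z (monomial a 1) ^ l := by
  simp only [eval_monomial, one_mul, Finsupp.prod_fintype _ _ fun _ => pow_zero _,
    ← Finset.prod_pow]
  exact Finset.prod_congr rfl fun v _ => pow_right_comm _ _ _

/-- The functional `f ↦ ∑_l τ_l x^l f(z^l)`. With `x = u z^a` it is the contraction by the monomial
of exponent `a` of the functional with `x = u`. -/
noncomputable def sampleForm (z : Fin r → k) {D : ℕ} (τ : Fin D → k) (x : k) :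
    MvPolynomial (Fin r) k →ₗ[k] k :=
  ∑ l : Fin D, (τ l * x ^ (l : ℕ)) • (LinearMap.proj l).comp (evalPoints z D)

theorem sampleForm_apply (z : Fin r → k) {D : ℕ} (τ : Fin D → k) (x : k)
    (f : MvPolynomial (Fin r) k) :
    sampleForm z τ x f = ∑ l : Fin D, τ l * x ^ (l : ℕ) * eval (fun v => z v ^ (l : ℕ)) f := by
  simp [sampleForm, evalPoints_apply]

theorem sampleForm_X_mul (z : Fin r → k) {D : ℕ} (τ : Fin D → k) (x : k) (v : Fin r)
    (f : MvPolynomial (Fin r) k) :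
    sampleForm z τ x (X v * f) = sampleForm z τ (z v * x) f := by
  simp only [sampleForm_apply, map_mul, eval_X, mul_pow]
  exact Finset.sum_congr rfl fun l _ => by ring

theorem linearIndependent_of_det_ne_zero {E : Type*} [AddCommGroup E] [Module k E] {n : ℕ}
    {b : Fin n → E} (T : E →ₗ[k] (Fin n → k)) (h : (Matrix.of fun y => T (b y)).det ≠ 0) :
    LinearIndependent k b :=
  LinearIndependent.of_comp T (Matrix.linearIndependent_rows_of_det_ne_zero h)

theorem le_finrank_map {E : Type*} [AddCommGroup E] [Module k E] {p : Submodule k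
    (MvPolynomial (Fin r) k)} [Module.Finite k p] {n : ℕ} {b : Fin n → MvPolynomial (Fin r) k}
    (hb : ∀ y, b y ∈ p) (S : MvPolynomial (Fin r) k →ₗ[k] E) (T : E →ₗ[k] (Fin n → k))
    (h : (Matrix.of fun y => T (S (b y))).det ≠ 0) : n ≤ Module.finrank k (p.map S) := by
  have hli : LinearIndependent k fun y => S (b y) := linearIndependent_of_det_ne_zero T h
  have h2 := finrank_span_eq_card hli
  rw [Fintype.card_fin] at h2
  rw [← h2]
  refine Submodule.finrank_mono ?_
  rw [Submodule.span_le]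
  rintro - ⟨y, rfl⟩
  exact Submodule.mem_map_of_mem (hb y)

/-- The points `z^0, …, z^(n-1)` impose as many conditions as possible on forms of degree `i`. -/
theorem finrank_map_evalPoints {z : Fin r → k}
    (hz : Function.Injective fun a : Fin r →₀ ℕ => eval z (monomial a 1)) (i n : ℕ) :
    Module.finrank k ((homogeneousSubmodule (Fin r) k i).map (evalPoints z n)) =
      min (N r i) n := by
  apply le_antisymm
  · refine le_min ?_ ?_
    · rw [← finrank_homogeneousSubmodule (k := k)]
      exact Submodule.finrank_map_le _ _
    · exact (Submodule.finrank_le _).trans (by simp)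
  · set m := min (N r i) n with hm
    have hcard : Fintype.card (monos r i) = N r i := by rw [Fintype.card_coe, card_monos]
    let a : Fin m → monos r i := fun y =>
      (Fintype.equivFinOfCardEq hcard).symm (Fin.castLE (min_le_left _ _) y)
    have ha : Function.Injective a :=
      (Equiv.injective _).comp (Fin.castLE_injective _)
    refine le_finrank_map (b := fun y => monomial (a y).1 1)
      (fun y => monomial_mem_homogeneousSubmodule (a y).2 1) _
      (LinearMap.funLeft k k (Fin.castLE (min_le_right _ _))) ?_
    have : (Matrix.of fun y => LinearMap.funLeft k k (Fin.castLE (min_le_right (N r i) n))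
        (evalPoints z n (monomial (a y).1 1))) =
        Matrix.vandermonde fun y : Fin m => eval z (monomial (a y).1 1) := by
      ext y l
      simp [LinearMap.funLeft_apply, evalPoints_apply, eval_pow_monomial,
        Matrix.vandermonde_apply]
    rw [this, Matrix.det_vandermonde_ne_zero_iff]
    exact hz.comp (Subtype.val_injective.comp ha)

/-- The determinants `det (∑_l τ_l (w_x v_y)^l)` are nonzero polynomials in `τ`: for `τ` the
indicator function of `{0, …, n-1}` the matrix is a product of two Vandermonde matrices. -/
theorem exists_polynomial_det {D n : ℕ} (hn : n ≤ D) {v w : Fin n → k}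
    (hv : Function.Injective v) (hw : Function.Injective w) :
    ∃ Q : MvPolynomial (Fin D) k, Q ≠ 0 ∧ ∀ τ, eval τ Q =
      (Matrix.of fun y x => ∑ l : Fin D, τ l * w x ^ (l : ℕ) * v y ^ (l : ℕ)).det := by
  refine ⟨(Matrix.of fun y x =>
    ∑ l : Fin D, X l * C (w x ^ (l : ℕ)) * C (v y ^ (l : ℕ))).det, ?_, ?_⟩
  swap
  · intro τ
    rw [RingHom.map_det]
    congr 1
    ext y x
    simp
  · intro h0
    have h1 := congrArg (eval fun l : Fin D => if (l : ℕ) < n then (1 : k) else 0) h0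
    rw [RingHom.map_det, map_zero] at h1
    have h2 : (eval fun l : Fin D => if (l : ℕ) < n then (1 : k) else 0).mapMatrix
        (Matrix.of fun y x => ∑ l : Fin D, X l * C (w x ^ (l : ℕ)) * C (v y ^ (l : ℕ))) =
        Matrix.vandermonde v * (Matrix.vandermonde w).transpose := by
      ext y x
      rw [Matrix.vandermonde_mul_vandermonde_transpose]
      simp only [RingHom.mapMatrix_apply, Matrix.map_apply, Matrix.of_apply, map_sum, map_mul,
        eval_X, eval_C, ite_mul, one_mul, zero_mul]
      rw [← Finset.sum_filter]
      symm
      refine Finset.sum_bij (fun l _ => Fin.castLE hn l) ?_ ?_ ?_ ?_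
      · intro l _; simp
      · intro l _ l' _ h; exact Fin.castLE_injective hn h
      · intro l hl
        exact ⟨⟨l, (Finset.mem_filter.1 hl).2⟩, Finset.mem_univ _, rfl⟩
      · intro l _
        simp [mul_pow, mul_comm]
    rw [h2, Matrix.det_mul, Matrix.det_transpose] at h1
    exact mul_ne_zero (Matrix.det_vandermonde_ne_zero_iff.2 hv)
      (Matrix.det_vandermonde_ne_zero_iff.2 hw) h1

theorem exists_forall_det_ne_zero [Infinite k] {ι : Type*} (S : Finset ι) {D : ℕ} (n : ι → ℕ)
    (v w : (i : ι) → Fin (n i) → k) (hn : ∀ i, n i ≤ D)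
    (hv : ∀ i, Function.Injective (v i)) (hw : ∀ i, Function.Injective (w i)) :
    ∃ τ : Fin D → k, ∀ i ∈ S,
      (Matrix.of fun y x => ∑ l : Fin D, τ l * w i x ^ (l : ℕ) * v i y ^ (l : ℕ)).det ≠ 0 := by
  choose Q hQ0 hQ using fun i => exists_polynomial_det (hn i) (hv i) (hw i)
  have h0 : ∏ i ∈ S, Q i ≠ 0 := Finset.prod_ne_zero_iff.2 fun i _ => hQ0 i
  obtain ⟨τ, hτ⟩ : ∃ τ, eval τ (∏ i ∈ S, Q i) ≠ 0 := by
    by_contra! hcon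
    exact h0 (MvPolynomial.funext fun τ => by rw [hcon, map_zero])
  rw [map_prod, Finset.prod_ne_zero_iff] at hτ
  exact ⟨τ, fun i hi => by rw [← hQ]; exact hτ i hi⟩

/-! ### Derivatives of generic forms -/

/-- The indices `(j, m, a)` of the derivatives of degree `i` of generators of degree at least `q`
(and at most `e`), there being `s j` generators of degree `j`: the `m`-th generator of degree `j` is
contracted by the monomial of exponent `a`, of degree `j - i`. -/
def derivIndex (r e : ℕ) (s : ℕ → ℕ) (i q : ℕ) : Finset (Σ _ : ℕ, ℕ × (Fin r →₀ ℕ)) :=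
  (Finset.Ico q (e + 1)).sigma fun j => Finset.range (s j) ×ˢ monos r (j - i)

theorem mem_derivIndex {e : ℕ} {s : ℕ → ℕ} {i q j m : ℕ} {a : Fin r →₀ ℕ} :
    (⟨j, m, a⟩ : Σ _ : ℕ, ℕ × (Fin r →₀ ℕ)) ∈ derivIndex r e s i q ↔
      (q ≤ j ∧ j ≤ e) ∧ m < s j ∧ a.degree = j - i := by
  simp [derivIndex, mem_monos]

theorem card_derivIndex_self (r e : ℕ) (s : ℕ → ℕ) (i : ℕ) :
    (derivIndex r e s i i).card = derivBound r e s i := by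
  rw [derivIndex, Finset.card_sigma, Finset.sum_Ico_eq_sum_range, derivBound]
  refine Finset.sum_congr rfl fun j _ => ?_
  rw [Finset.card_product, Finset.card_range, card_monos, mul_comm, Nat.add_sub_cancel_left]

theorem card_derivIndex_succ (r e : ℕ) (s : ℕ → ℕ) {i : ℕ} (hi : i ≤ e) :
    s i + (derivIndex r e s i (i + 1)).card = derivBound r e s i := by
  rw [derivIndex, Finset.card_sigma, Finset.sum_Ico_eq_sum_range, derivBound_eq_add r e s hi,
    show e + 1 - (i + 1) = e - i by omega]
  congr 1
  refine Finset.sum_congr rfl fun j _ => ?_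
  rw [Finset.card_product, Finset.card_range, card_monos, mul_comm,
    show i + 1 + j - i = j + 1 by omega]

theorem derivIndex_eq_empty {e : ℕ} {s : ℕ → ℕ} {i q : ℕ} (hq : e < q) :
    derivIndex r e s i q = ∅ := by
  rw [derivIndex, Finset.Ico_eq_empty (by omega)]
  rfl

/-- The values on a polynomial of the functionals with indices in `W`. -/
noncomputable def derivForms (z : Fin r → k) (u : ℕ → ℕ → k) {D : ℕ} (τ : Fin D → k)
    (W : Finset (Σ _ : ℕ, ℕ × (Fin r →₀ ℕ))) : MvPolynomial (Fin r) k →ₗ[k] (W → k) :=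
  LinearMap.pi fun x => sampleForm z τ (eval z (monomial x.1.2.2 1) * u x.1.1 x.1.2.1)

theorem derivForms_eq_zero_iff {z : Fin r → k} {u : ℕ → ℕ → k} {D : ℕ} {τ : Fin D → k}
    {W : Finset (Σ _ : ℕ, ℕ × (Fin r →₀ ℕ))} {f : MvPolynomial (Fin r) k} :
    derivForms z u τ W f = 0 ↔
      ∀ j m a, ⟨j, m, a⟩ ∈ W → sampleForm z τ (eval z (monomial a 1) * u j m) f = 0 := by
  rw [funext_iff]
  constructor
  · intro h j m a hx
    exact h ⟨⟨j, m, a⟩, hx⟩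
  · rintro h ⟨⟨j, m, a⟩, hx⟩
    exact h j m a hx

/-- A form vanishing at the points involved is killed by all the functionals. -/
theorem derivForms_eq_zero_of_evalPoints {z : Fin r → k} {u : ℕ → ℕ → k} {D : ℕ} {τ : Fin D → k}
    {W : Finset (Σ _ : ℕ, ℕ × (Fin r →₀ ℕ))} {f : MvPolynomial (Fin r) k}
    (hf : evalPoints z D f = 0) : derivForms z u τ W f = 0 := by
  rw [derivForms_eq_zero_iff]
  intro j m a _
  rw [sampleForm_apply]
  refine Finset.sum_eq_zero fun l _ => ?_
  rw [← evalPoints_apply, hf, Pi.zero_apply, mul_zero]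

/-- For generic coefficients `τ`, the derivatives of degree `i` of the generators of degree at least
`q` span a space of the largest conceivable dimension. -/
theorem exists_generic [Infinite k] {z : Fin r → k} {u : ℕ → ℕ → k}
    (hinj : Function.Injective fun x : Σ _ : ℕ, ℕ × (Fin r →₀ ℕ) =>
      eval z (monomial x.2.2 1) * u x.1 x.2.1) (e : ℕ) (s : ℕ → ℕ) (D : ℕ) :
    ∃ τ : Fin D → k, ∀ i q, i ≤ q → Module.finrank k ((homogeneousSubmodule (Fin r) k i).map
      (derivForms z u τ (derivIndex r e s i q))) =
        min (N r i) (min D (derivIndex r e s i q).card) := by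
  have hz : Function.Injective fun a : Fin r →₀ ℕ => eval z (monomial a 1) := fun a b hab => by
    have := @hinj ⟨0, 0, a⟩ ⟨0, 0, b⟩ (by
      simpa using Or.inl hab)
    simpa using this
  set n : ℕ × ℕ → ℕ := fun x => min (N r x.1) (min D (derivIndex r e s x.1 x.2).card) with hn
  have hcard : ∀ i, Fintype.card (monos r i) = N r i := fun i => by
    rw [Fintype.card_coe, card_monos]
  let a : (x : ℕ × ℕ) → Fin (n x) → monos r x.1 := fun x y =>
    (Fintype.equivFinOfCardEq (hcard x.1)).symm (Fin.castLE (min_le_left _ _) y)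
  have ha : ∀ x, Function.Injective (a x) := fun x =>
    (Equiv.injective _).comp (Fin.castLE_injective _)
  let b : (x : ℕ × ℕ) → Fin (n x) → derivIndex r e s x.1 x.2 := fun x y =>
    (Fintype.equivFinOfCardEq (Fintype.card_coe _)).symm
      (Fin.castLE ((min_le_right _ _).trans (min_le_right _ _)) y)
  have hb : ∀ x, Function.Injective (b x) := fun x =>
    (Equiv.injective _).comp (Fin.castLE_injective _)
  obtain ⟨τ, hτ⟩ := exists_forall_det_ne_zero (k := k)
    (Finset.range (e + 1) ×ˢ Finset.range (e + 1)) (D := D) n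
    (fun x y => eval z (monomial (a x y).1 1))
    (fun x y => eval z (monomial (b x y).1.2.2 1) * u (b x y).1.1 (b x y).1.2.1)
    (fun x => (min_le_right _ _).trans (min_le_left _ _))
    (fun x => hz.comp (Subtype.val_injective.comp (ha x)))
    (fun x => hinj.comp (Subtype.val_injective.comp (hb x)))
  refine ⟨τ, fun i q hiq => ?_⟩
  apply le_antisymm
  · refine le_min ?_ (le_min ?_ ?_)
    · rw [← finrank_homogeneousSubmodule (k := k)]
      exact Submodule.finrank_map_le _ _
    · refine le_trans ?_ ((finrank_map_evalPoints (k := k) hz i D).le.trans (min_le_right _ _))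
      have h1 := finrank_map_inf_ker_add (homogeneousSubmodule (Fin r) k i)
        (f := evalPoints z D) (g := derivForms z u τ (derivIndex r e s i q))
        fun f _ hf => derivForms_eq_zero_of_evalPoints hf
      omega
    · exact (Submodule.finrank_le _).trans (by simp)
  · rcases Nat.lt_or_ge e q with hq | hq
    · rw [derivIndex_eq_empty hq]; simp
    · have hdet := hτ (i, q) (by simp; omega)
      refine le_finrank_map (b := fun y => monomial (a (i, q) y).1 1)
        (fun y => monomial_mem_homogeneousSubmodule (a (i, q) y).2 1) _
        (LinearMap.funLeft k k (b (i, q))) ?_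
      convert hdet using 2
      ext y x
      simp only [Matrix.of_apply, LinearMap.funLeft_apply, derivForms, LinearMap.pi_apply,
        sampleForm_apply, eval_pow_monomial]

end

section

open MvPolynomial

/-! ### The construction -/

section Family

variable {k : Type*} [Field k] {r : ℕ}

/-- The forms of degree `i` in the ideal to be constructed: for `i ≤ t` those vanishing at the first
`h i` points, for `i > t` those killed by the derivatives of degree `i` of the generic
generators. -/
noncomputable def pointFamily (z : Fin r → k) (u : ℕ → ℕ → k) {D : ℕ} (τ : Fin D → k) (e t : ℕ)
    (s h : ℕ → ℕ) (i : ℕ) : Submodule k (MvPolynomial (Fin r) k) :=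
  if i ≤ t then LinearMap.ker (evalPoints z (h i))
  else LinearMap.ker (derivForms z u τ (derivIndex r e s i i))

variable {z : Fin r → k} {u : ℕ → ℕ → k} {D : ℕ} {τ : Fin D → k} {e t : ℕ} {s h : ℕ → ℕ}

theorem evalPoints_eq_zero_iff {n : ℕ} {f : MvPolynomial (Fin r) k} :
    evalPoints z n f = 0 ↔ ∀ l < n, eval (fun v => z v ^ l) f = 0 := by
  rw [funext_iff]
  simp only [evalPoints_apply, Pi.zero_apply]
  exact ⟨fun h l hl => h ⟨l, hl⟩, fun h l => h l l.2⟩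

/-- Forms vanish at the points as soon as their products with the variables do, since the points
have nonzero coordinates. -/
theorem mem_colon_ker_evalPoints (hr : 0 < r) (hz0 : ∀ v, z v ≠ 0) {n : ℕ}
    {f : MvPolynomial (Fin r) k} :
    f ∈ colon (LinearMap.ker (evalPoints z n)) ↔ evalPoints z n f = 0 := by
  simp only [mem_colon, LinearMap.mem_ker, evalPoints_eq_zero_iff, map_mul, eval_X]
  constructor
  · intro h l hl
    exact (mul_eq_zero.1 (h ⟨0, hr⟩ l hl)).resolve_left (pow_ne_zero _ (hz0 _))
  · intro h v l hl
    rw [h l hl, mul_zero]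

theorem eval_monomial_add_single (z : Fin r → k) (a : Fin r →₀ ℕ) (v : Fin r) :
    eval z (monomial (a + Finsupp.single v 1) 1) = eval z (monomial a 1) * z v := by
  rw [← mul_one (1 : k), ← monomial_mul, map_mul, mul_one, ← X, eval_X]

/-- The products of `f` with the variables are killed by the derivatives of degree `i + 1` exactly
when `f` is killed by the derivatives of degree `i` of the generators of degree at least `i + 1`. -/
theorem mem_colon_ker_derivForms {i : ℕ} {f : MvPolynomial (Fin r) k} :
    f ∈ colon (LinearMap.ker (derivForms z u τ (derivIndex r e s (i + 1) (i + 1)))) ↔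
      derivForms z u τ (derivIndex r e s i (i + 1)) f = 0 := by
  simp only [mem_colon, LinearMap.mem_ker, derivForms_eq_zero_iff, mem_derivIndex,
    sampleForm_X_mul]
  constructor
  · rintro h j m a ⟨hj, hm, ha⟩
    obtain ⟨v, hv⟩ : ∃ v, a v ≠ 0 := by
      by_contra! hcon
      have : a = 0 := Finsupp.ext hcon
      rw [this, map_zero] at ha
      omega
    have hle : Finsupp.single v 1 ≤ a := by rw [Finsupp.single_le_iff]; omega
    have hcancel := tsub_add_cancel_of_le hle
    have h1 := h v j m (a - Finsupp.single v 1) ⟨hj, hm, by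
      rw [← hcancel, map_add, Finsupp.degree_single] at ha
      omega⟩
    rw [← hcancel, eval_monomial_add_single]
    rwa [show eval z (monomial (a - Finsupp.single v 1) 1) * z v * u j m =
      z v * (eval z (monomial (a - Finsupp.single v 1) 1) * u j m) by ring]
  · rintro h v j m a ⟨hj, hm, ha⟩
    have h1 := h j m (a + Finsupp.single v 1) ⟨hj, hm, by
      rw [map_add, Finsupp.degree_single]
      omega⟩
    rw [eval_monomial_add_single] at h1
    rwa [show z v * (eval z (monomial a 1) * u j m) =
      eval z (monomial a 1) * z v * u j m by ring]

theorem eq_zero_of_evalPoints {i n : ℕ}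
    (hz : Function.Injective fun a : Fin r →₀ ℕ => eval z (monomial a 1)) (hn : N r i ≤ n)
    {f : MvPolynomial (Fin r) k} (hf : f ∈ homogeneousSubmodule (Fin r) k i)
    (hf0 : evalPoints z n f = 0) : f = 0 := by
  have h1 := finrank_map_add_finrank_inf_ker (homogeneousSubmodule (Fin r) k i) (evalPoints z n)
  rw [finrank_map_evalPoints hz, finrank_homogeneousSubmodule, min_eq_left hn] at h1
  have : Module.Finite k
      (homogeneousSubmodule (Fin r) k i ⊓ LinearMap.ker (evalPoints z n) : Submodule k _) :=
    Submodule.finiteDimensional_inf_left _ _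
  have h2 : homogeneousSubmodule (Fin r) k i ⊓ LinearMap.ker (evalPoints z n) = ⊥ :=
    Submodule.finrank_eq_zero.1 (by omega)
  rw [← Submodule.mem_bot k, ← h2]
  exact ⟨hf, hf0⟩

end Family

/-- Existence of algebras. In degrees `i ≤ t` the dual of the algebra is spanned by evaluations at
`h i` points, and its generators beyond degree `t` are generic combinations of evaluations at `D`
points, where `D` is `h t - s t` unless more are needed and allowed. -/
theorem admissible_of_numerics (k : Type*) [Field k] [CharZero k] {r e t : ℕ} (hr : 0 < r)
    (hte : t < e) {s h : ℕ → ℕ} (hs : ∀ i, e < i → s i = 0) (h1 : h 1 = r)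
    (hN : ∀ i ≤ t, h i ≤ N r i) (hlow : ∀ i < t, s i + min (N r i) (h (i + 1)) = h i)
    (hst : s t ≤ h t) (ht : h t ≤ derivBound r e s t)
    (hhigh : ∀ i, t < i → h i = derivBound r e s i ∧ h i ≤ N r i)
    (hcase : derivBound r e s (t + 1) ≤ h t - s t ∨ (h t = N r t ∧ s t = 0)) :
    Admissible k r s h := by
  obtain ⟨z, u, hz0, hinj⟩ := exists_nodes (k := k) r
  have hz : Function.Injective fun a : Fin r →₀ ℕ => eval z (monomial a 1) := fun a b hab => by
    have := @hinj ⟨0, 0, a⟩ ⟨0, 0, b⟩ (by simpa using Or.inl hab)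
    simpa using this
  set D := max (derivBound r e s (t + 1)) (h t - s t) with hD
  obtain ⟨τ, hτ⟩ := exists_generic (z := z) (u := u) hinj e s D
  have hlow_gen : ∀ i ≤ t, pointFamily z u τ e t s h i = LinearMap.ker (evalPoints z (h i)) :=
    fun i hi => if_pos hi
  have hhigh_gen : ∀ i, t < i → pointFamily z u τ e t s h i =
      LinearMap.ker (derivForms z u τ (derivIndex r e s i i)) := fun i hi => if_neg (by omega)
  have hmono : ∀ n m, n ≤ m → ∀ f : MvPolynomial (Fin r) k,
      evalPoints z m f = 0 → evalPoints z n f = 0 := fun n m hnm f hf => by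
    rw [evalPoints_eq_zero_iff] at hf ⊢
    exact fun l hl => hf l (by omega)
  refine admissible_of_family (K := pointFamily z u τ e t s h) (e := e) ?_ ?_ h1 ?_ ?_
  · intro i v f hf hfK
    suffices f ∈ colon (pointFamily z u τ e t s h (i + 1)) from mem_colon.1 this v
    rcases Nat.lt_trichotomy i t with hi | rfl | hi
    · rw [hlow_gen i hi.le] at hfK
      rw [hlow_gen (i + 1) hi, mem_colon_ker_evalPoints hr hz0]
      have h2 := hlow i hi
      rcases Nat.lt_or_ge (N r i) (h (i + 1)) with h3 | h3
      · rw [eq_zero_of_evalPoints hz (by omega) hf hfK, map_zero]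
      · exact hmono _ (h i) (by omega) f hfK
    · rw [hlow_gen i le_rfl] at hfK
      rw [hhigh_gen (i + 1) (by omega), mem_colon_ker_derivForms]
      refine derivForms_eq_zero_of_evalPoints ?_
      rcases hcase with h2 | h2
      · exact hmono _ (h i) (by omega) f hfK
      · rw [eq_zero_of_evalPoints hz (by omega) hf hfK, map_zero]
    · rw [hhigh_gen i hi, LinearMap.mem_ker, derivForms_eq_zero_iff] at hfK
      rw [hhigh_gen (i + 1) (by omega), mem_colon_ker_derivForms, derivForms_eq_zero_iff]
      intro j m a hx
      refine hfK j m a ?_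
      rw [mem_derivIndex] at hx ⊢
      omega
  · intro i hi f _
    rw [hhigh_gen i (by omega), LinearMap.mem_ker, derivForms_eq_zero_iff,
      derivIndex_eq_empty hi]
    simp
  · intro i
    rcases Nat.lt_or_ge t i with hi | hi
    · have hDi := derivBound_antitone hr e s (show t + 1 ≤ i from hi)
      have h2 := hhigh i hi
      have h3 := hτ i i le_rfl
      rw [card_derivIndex_self] at h3
      rw [hhigh_gen i hi, finrank_map_eq_of_ker
        (g := derivForms z u τ (derivIndex r e s i i)) _ (by simp), h3]
      omega
    · have h2 := hN i hi
      rw [hlow_gen i hi, finrank_map_eq_of_ker (g := evalPoints z (h i)) _ (by simp),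
        finrank_map_evalPoints hz]
      omega
  · intro i
    rcases Nat.lt_or_ge i t with hi | hi
    · rw [hlow_gen (i + 1) hi, finrank_map_eq_of_ker (g := evalPoints z (h (i + 1))) _
        (fun f _ => by simpa using mem_colon_ker_evalPoints hr hz0), finrank_map_evalPoints hz]
      exact hlow i hi
    · rw [hhigh_gen (i + 1) (by omega), finrank_map_eq_of_ker
        (g := derivForms z u τ (derivIndex r e s i (i + 1))) _
        (fun f _ => by simpa using mem_colon_ker_derivForms), hτ i (i + 1) (by omega)]
      rcases Nat.lt_or_ge e i with hie | hie
      · rw [derivIndex_eq_empty (by omega), (hhigh i (by omega)).1, derivBound_eq_zero s hie,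
          hs i hie]
        simp
      · have h2 := card_derivIndex_succ r e s hie
        rcases hi.lt_or_eq with hi | rfl
        · have hDi := derivBound_antitone hr e s (show t + 1 ≤ i from hi)
          have h3 := hhigh i hi
          omega
        · have h3 := hN t le_rfl
          omega

/-- Every socle-vector occurs, with `h_i = s_i + ⋯ + s_e` for `i ≥ 1`, the `h`-vector of a connected
sum of truncated polynomial rings in one variable, one for each generator of the socle. -/
theorem exists_admissible (k : Type*) [Field k] [CharZero k] {e : ℕ} (he : 1 < e) {s : ℕ → ℕ}
    (hs0 : s 0 = 0) (hse : 0 < s e) (hs : ∀ i, e < i → s i = 0) :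
    ∃ (ρ : ℕ) (h : ℕ → ℕ), Admissible k ρ s h := by
  set g : ℕ → ℕ := fun i => ∑ j ∈ Finset.Ico i (e + 1), s j with hg
  have hge : g e = s e := by simp [hg]
  have hgsucc : ∀ i ≤ e, g i = s i + g (i + 1) := fun i hi =>
    Finset.sum_eq_sum_Ico_succ_bot (by omega) s
  have hgzero : ∀ i, e < i → g i = 0 := fun i hi => by
    simp [hg, Finset.Ico_eq_empty (show ¬ i < e + 1 by omega)]
  have hganti : Antitone g := antitone_nat_of_succ_le fun i => by
    rcases Nat.lt_or_ge e i with hi | hi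
    · rw [hgzero (i + 1) (by omega)]; omega
    · rw [hgsucc i hi]; omega
  have hg1 : 0 < g 1 := lt_of_lt_of_le (hge ▸ hse) (hganti he.le)
  have hgN : ∀ i, 1 ≤ i → g i ≤ N (g 1) i := fun i hi =>
    (hganti hi).trans ((N_one (g 1)).symm.le.trans (N_mono_right hg1 hi))
  have hset := hgsucc (e - 1) (by omega)
  have hdset := derivBound_succ_le hg1 e s (e - 1)
  rw [show e - 1 + 1 = e by omega] at hset hdset
  rw [derivBound_self] at hdset
  refine ⟨g 1, fun i => if i = 0 then 1 else g i, admissible_of_numerics k (t := e - 1)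
    hg1 (by omega) hs (by simp) ?_ ?_ ?_ ?_ ?_ ?_⟩
  · intro i _
    rcases Nat.eq_zero_or_pos i with rfl | hi
    · simp [N_zero]
    · simpa [hi.ne'] using hgN i hi
  · intro i hie
    rcases Nat.eq_zero_or_pos i with rfl | hi
    · simp only [N_zero, hs0]; simp; omega
    · have h1 := hgN i hi
      have h2 := hgsucc i (by omega)
      simp only [hi.ne', if_false, Nat.succ_ne_zero]
      omega
  · rw [if_neg (by omega)]; omega
  · rw [if_neg (by omega)]; omega
  · intro i hi
    rw [if_neg (by omega)]
    refine ⟨?_, hgN i (by omega)⟩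
    rcases Nat.lt_or_ge e i with hie | hie
    · rw [hgzero i hie, derivBound_eq_zero s hie]
    · obtain rfl : i = e := by omega
      rw [hge, derivBound_self]
  · left
    rw [if_neg (by omega), show e - 1 + 1 = e by omega, derivBound_self]
    omega

end

/-! ### The last index of growth is not the socle degree -/

/-- Some algebra with socle-vector `s` in at most `r` variables obeys, from degree `c` on, the same
recursion as `H`; its socle in degree `e` then fits into `H_e`. -/
theorem socle_le_upperBound (k : Type*) [Field k] [CharZero k] {r e : ℕ} (hr : 1 < r) (he : 1 < e)
    {s : ℕ → ℕ} (hs0 : s 0 = 0) (hse : 0 < s e) (hs : ∀ i, e < i → s i = 0)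
    (hmin : minEmbDim k s ≤ r) {c t : ℕ} (hc1 : 1 ≤ c) (hce : c ≤ e)
    (hc : upperBound r e s c = N r c) (ht : IsLastGrowth r e s t) (hte : t = e)
    (hsmall : c < e → upperBound r e s c - s c ≤ c) : s e ≤ upperBound r e s e := by
  obtain ⟨h, I, hI⟩ : ∃ h : ℕ → ℕ, Admissible k (minEmbDim k s) s h := by
    obtain ⟨ρ, h, hρ⟩ := exists_admissible k he hs0 hse hs
    exact Nat.sInf_mem (s := {ρ | ∃ h : ℕ → ℕ, Admissible k ρ s h}) ⟨ρ, h, hρ⟩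
  have key : ∀ i, c ≤ i → i ≤ e → h i ≤ upperBound r e s i := by
    intro i hi
    induction i, hi using Nat.le_induction with
    | base =>
      intro _
      rw [hc]
      exact (hI.le_N c).trans (N_mono_left hmin c)
    | succ i hi ih =>
      intro hie
      have h1 := ih (by omega)
      have h2 := hsmall (by omega)
      have h3 := (upperBound_succ_of_small hc1 h2 hi).1
      have h4 := upperBound_succ_of_small_of_lt (by omega) hc1 h2 ht hi (by omega)
      have h5 := hI.succ_le (i := i) (by omega)
      omega
  exact (hI.socle_le e).trans (key e hce le_rfl)

end SocleData

open SocleData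

theorem theoremB (k : Type*) [Field k] [CharZero k] (r e : ℕ) (hr : 1 < r) (he : 1 < e)
    (s : ℕ → ℕ) (hs0 : s 0 = 0) (hse : 0 < s e) (hs : ∀ i, e < i → s i = 0)
    (hmin : SocleData.minEmbDim k s ≤ r)
    (c t : ℕ) (hc : SocleData.IsLastGeneric r e s c) (ht : SocleData.IsLastGrowth r e s t)
    (hcases : c = t + 1 ∨
      (c = t ∧ (s c : ℤ) ≤
        max ((SocleData.N r c : ℤ) - (SocleData.upperBound r e s (c + 1) : ℤ)) 0) ∨
      ((c : ℤ) ≤ (t : ℤ) - 1 ∧ (SocleData.N r c : ℤ) - (c : ℤ) ≤ (s c : ℤ))) :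
    SocleData.Admissible k r s (SocleData.upperBound r e s) := by
  have hcN : upperBound r e s c = N r c := hc.1.2
  have hce : c ≤ e := hc.1.1
  have hc1 : 1 ≤ c := hc.2 ⟨by omega, by simp [upperBound, N_one]⟩
  have hlow := fun i (hi : i < c) => generic_of_generic hr e hs0 hcN hi
  have hhigh := fun i (hi : t < i) => upperBound_eq_derivBound hr he hse ht hi
  have hgrowth : upperBound r e s t < derivBound r e s t := ht.1.2.1 ▸ ht.1.2.2
  have hNle := upperBound_le_N hr e s
  -- If `t = e`, then `h_e` is less than `s_e`, which no algebra in `r` variables allows.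
  have hte : t < e := by
    rcases ht.1.1.lt_or_eq with h | h
    · exact h
    · have h1 := socle_le_upperBound k hr he hs0 hse hs hmin hc1 hce hcN ht h
        (by rw [hcN]; omega)
      rw [h, derivBound_self] at hgrowth
      omega
  have hpos : 0 < upperBound r e s (t + 1) := by
    rw [hhigh (t + 1) (by omega)]
    exact (N_pos (by omega) _).trans_le (N_le_derivBound hse (by omega))
  have hgen : ∀ i < t, i < c → s i + min (N r i) (upperBound r e s (i + 1)) =
      upperBound r e s i := fun i _ hi => by
    have h1 := hlow i hi
    have h2 : upperBound r e s (i + 1) = N r (i + 1) := by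
      rcases Nat.lt_or_ge (i + 1) c with h | h
      · exact (hlow _ h).1
      · rw [show i + 1 = c by omega, hcN]
    have h3 := N_le_succ (show 0 < r by omega) i
    omega
  rcases hcases with hct | ⟨rfl, hsc⟩ | ⟨hct, hsc⟩
  · have h1 := hlow t (by omega)
    refine admissible_of_numerics k (by omega) hte hs (by simp [upperBound]) (fun i _ => hNle i)
      (fun i hi => hgen i hi (by omega)) (by omega) hgrowth.le
      (fun i hi => ⟨hhigh i hi, hNle i⟩) (Or.inr h1)
  · have h1 := hhigh (c + 1) (by omega)
    refine admissible_of_numerics k (by omega) hte hs (by simp [upperBound]) (fun i _ => hNle i)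
      (fun i hi => hgen i hi hi) (by omega) hgrowth.le
      (fun i hi => ⟨hhigh i hi, hNle i⟩) (by omega)
  · have hsmall : upperBound r e s c - s c ≤ c := by omega
    have hstep := fun i (hi : c ≤ i) (hit : i < t) =>
      upperBound_succ_of_small_of_lt (by omega) hc1 hsmall ht hi hit
    have ht1 := (upperBound_succ_of_small hc1 hsmall (show c ≤ t by omega)).2.2
    -- No subtraction is truncated up to degree `t`, because `h_{t+1}` is positive.
    have hlt : ∀ d i, c ≤ i → i + d = t → s i < upperBound r e s i := by
      intro d
      induction d with
      | zero => rintro i hi rfl; simp only [add_zero] at *; omega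
      | succ d ih =>
        intro i hi hit
        have h1 := ih (i + 1) (by omega) (by omega)
        have h2 := hstep i hi (by omega)
        omega
    have hst := hlt 0 t (by omega) rfl
    have h1 := hhigh (t + 1) (by omega)
    refine admissible_of_numerics k (by omega) hte hs (by simp [upperBound]) (fun i _ => hNle i)
      (fun i hi => ?_) hst.le hgrowth.le (fun i hi => ⟨hhigh i hi, hNle i⟩) (by omega)
    rcases Nat.lt_or_ge i c with hic | hic
    · exact hgen i hi hic
    · have h2 := hlt (t - i) i hic (by omega)
      have h3 := hstep i hic hi
      have h4 := hNle i
      omega
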